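/- Let $\theta_3(x)=\sum_{n=-\infty}^{\infty}e^{-\pi n^2x}$ for $\operatorname{Re}x>0$, let $$\sigma_3(z)=\frac{1}{\sqrt{1+z}}\,\theta_3\!\left(\frac{1-z}{1+z}\right)\qquad(|z|<1)$$ with the principal square root, and let $\Omega=\dfrac{\Gamma(1/4)^8}{32\pi^4}$ and $\Phi=\Omega/4$. There is a (necessarily unique) sequence of integers $(d(n))_{n\ge 0}$ such that $$\sigma_3(z)=\theta_3(1)\sum_{n=0}^\infty\frac{d(n)}{(2n)!}\,\Phi^n z^{2n}\qquad(|z|<1),$$ and for this sequence and every integer $k\ge 0$ the following series converges and $$\sum_{n=-\infty}^\infty n^{2k}e^{-\pi n^2}=\frac{\pi^{1/4}}{\Gamma(3/4)}\cdot\frac{1}{(4\pi)^k}\sum_{j=0}^{\lfloor k/2\rfloor}\frac{(2k)!}{2^{k-2j}\,(4j)!\,(k-2j)!}\,d(j)\,\Omega^j,$$ where $0^0=1$ is used in the term $n=0$ on the left when $k=0$. -/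

import Mathlib

open scoped Real Nat

noncomputable section

/-- The Jacobi theta constant `θ₃(x) = ∑_{n ∈ ℤ} exp (-π n² x)`, meant for `Re x > 0`. -/
def theta3 (x : ℂ) : ℂ := ∑' n : ℤ, Complex.exp (-(π : ℂ) * (n : ℂ) ^ 2 * x)

/-- `theta3 x` is Mathlib's one-variable theta function at `τ = i x`. -/
theorem theta3_eq_jacobiTheta (x : ℂ) : theta3 x = jacobiTheta (Complex.I * x) := by
  unfold theta3 jacobiTheta
  refine tsum_congr fun n => ?_
  congr 1
  linear_combination (-(π : ℂ) * (n : ℂ) ^ 2 * x) * Complex.I_sq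

/-- The centered theta function `σ₃(z) = (1 + z)^(-1/2) θ₃((1 - z) / (1 + z))`, meant for
`|z| < 1`, with the principal branch of the square root. -/
def sigma3 (z : ℂ) : ℂ := 1 / (1 + z) ^ (1 / 2 : ℂ) * theta3 ((1 - z) / (1 + z))

/-- The constant `Ω = Γ(1/4)⁸ / (32 π⁴)`. -/
def thetaOmega : ℝ := Real.Gamma (1 / 4) ^ 8 / (32 * π ^ 4)

/-- The constant `Φ = Ω / 4`. -/
def thetaPhi : ℝ := thetaOmega / 4

/-- The sequence `d` is the sequence of normalized Taylor coefficients of `σ₃` at `0`: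
`σ₃(z) = θ₃(1) ∑_{n ≥ 0} d(n) / (2n)! Φⁿ z²ⁿ` for `|z| < 1`. -/
def IsSigma3Coeff (d : ℕ → ℤ) : Prop :=
  ∀ z : ℂ, ‖z‖ < 1 →
    HasSum (fun n : ℕ => theta3 1 * ((d n : ℂ) / ((2 * n)! : ℂ) * (thetaPhi : ℂ) ^ n * z ^ (2 * n)))
      (sigma3 z)

end

/-! ### The series φ(q) and ψ(q) and their quadratic identities. -/

section

open Filter Topology Complex

/-! The sums on the left are, up to the factor (-2π)^k, the derivatives at u = 0 of θ₃(1 + 2u). The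
Cayley variable z = -u/(1+u) gives θ₃(1 + 2u) = (1+u)^(-1/2) σ₃(-u/(1+u)) (`theta3_eq_sigma3`), so
the moment formula is a change of variables in Taylor expansions (`iteratedDeriv_theta3_eq_sum`).
The content lies in the integrality of d(n), the evenness of σ₃ and the value of θ₃(1).

Integrality comes from a differential system. With D = (πi)⁻¹ d/dτ, the logarithmic derivatives of
θ₂, θ₃, θ₄ differ by multiples of fourth powers of theta functions, and D(Dθ₃/θ₃) - 2(Dθ₃/θ₃)² =
θ₂⁴θ₄⁴/8 (`logD_jTheta2`, `logD_jTheta4`, `logD₂_jTheta3`). Each identity is written as the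
vanishing of one coordinate of a holomorphic vector. Translation and inversion permute its
coordinates up to sign and it tends to 0 at i∞, so the maximum principle
(`eq_zero_of_norm_invariant`) kills it. Transported to the disk and rescaled by √Φ, the identities
become a polynomial system with integer coefficients and initial value (1, 0, 0) at z = 0; hence
every derivative of σ₃/θ₃(1) at 0 is an integer times a power of √Φ
(`exists_int_iteratedDeriv_sigma3`). Inversion acts on the disk as z ↦ -z, which makes σ₃ even
(`sigma3_neg`).

The value of θ₃(1) comes from the arithmetic-geometric mean. The pair φ(q)², φ(-q)² is one AGM step
away from the pair at q², so the elliptic integral of that pair is π/2 (`ellipticI_phiReal`). At τ =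
i the modulus is lemniscatic and the integral is a Beta value (`integral_lemniscate`), which gives
`phiReal_exp_neg_pi`. -/

/-- The exponents `n²`. -/
def sqExp (n : ℤ) : ℕ := (n ^ 2).natAbs

/-- The exponents `n(n+1)`. -/
def oblongExp (n : ℤ) : ℕ := (n * (n + 1)).natAbs

lemma coe_sqExp (n : ℤ) : (sqExp n : ℤ) = n ^ 2 := by
  rw [sqExp, Int.natCast_natAbs, abs_of_nonneg (sq_nonneg n)]

lemma coe_oblongExp (n : ℤ) : (oblongExp n : ℤ) = n * (n + 1) := by
  rw [oblongExp, Int.natCast_natAbs, abs_of_nonneg]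
  rcases le_or_gt 0 n with h | h <;> nlinarith

/-- `φ(q) = ∑ q^(n²)`. -/
noncomputable def phiSeries (q : ℂ) : ℂ := ∑' n : ℤ, q ^ sqExp n

/-- `ψ(q) = ∑ q^(n(n+1))`. -/
noncomputable def psiSeries (q : ℂ) : ℂ := ∑' n : ℤ, q ^ oblongExp n

lemma summable_pow_of_le {e : ℤ → ℕ} (h₁ : ∀ n : ℕ, n ≤ e n) (h₂ : ∀ n : ℕ, n ≤ e (-(n + 1)))
    {r : ℝ} (h0 : 0 ≤ r) (hr : r < 1) : Summable fun n : ℤ => r ^ e n := by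
  have hg := summable_geometric_of_lt_one h0 hr
  refine Summable.of_nat_of_neg_add_one (f := fun n : ℤ => r ^ e n) ?_ ?_
  · exact hg.of_nonneg_of_le (fun n => by positivity)
      (fun n => pow_le_pow_of_le_one h0 hr.le (h₁ n))
  · exact hg.of_nonneg_of_le (fun n => by positivity)
      (fun n => pow_le_pow_of_le_one h0 hr.le (h₂ n))

lemma summable_pow_sqExp {r : ℝ} (h0 : 0 ≤ r) (hr : r < 1) :
    Summable fun n : ℤ => r ^ sqExp n := by
  refine summable_pow_of_le (fun n => ?_) (fun n => ?_) h0 hr <;> zify <;> rw [coe_sqExp] <;>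
    nlinarith

lemma summable_pow_oblongExp {r : ℝ} (h0 : 0 ≤ r) (hr : r < 1) :
    Summable fun n : ℤ => r ^ oblongExp n := by
  refine summable_pow_of_le (fun n => ?_) (fun n => ?_) h0 hr <;> zify <;> rw [coe_oblongExp] <;>
    nlinarith

lemma differentiableOn_tsum_pow {e : ℤ → ℕ}
    (he : ∀ r : ℝ, 0 ≤ r → r < 1 → Summable fun n : ℤ => r ^ e n) :
    DifferentiableOn ℂ (fun q : ℂ => ∑' n : ℤ, q ^ e n) (Metric.ball 0 1) := by
  intro q hq
  rw [mem_ball_zero_iff] at hq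
  obtain ⟨r, hqr, hr⟩ := exists_between hq
  have h := differentiableOn_tsum_of_summable_norm (U := Metric.ball (0 : ℂ) r)
    (F := fun (n : ℤ) (q : ℂ) => q ^ e n)
    (he r ((norm_nonneg q).trans hqr.le) hr) (fun n => (differentiable_pow _).differentiableOn)
    Metric.isOpen_ball (fun n w hw => by
      rw [norm_pow]
      exact pow_le_pow_left₀ (norm_nonneg w) (mem_ball_zero_iff.1 hw).le _)
  exact (h.differentiableAt (Metric.isOpen_ball.mem_nhds
    (mem_ball_zero_iff.2 hqr))).differentiableWithinAt

lemma differentiableOn_phiSeries : DifferentiableOn ℂ phiSeries (Metric.ball 0 1) :=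
  differentiableOn_tsum_pow fun _ => summable_pow_sqExp

lemma differentiableOn_psiSeries : DifferentiableOn ℂ psiSeries (Metric.ball 0 1) :=
  differentiableOn_tsum_pow fun _ => summable_pow_oblongExp

lemma norm_summable_sq {q : ℂ} (hq : ‖q‖ < 1) : Summable fun n : ℤ => ‖q ^ sqExp n‖ := by
  simpa only [norm_pow] using summable_pow_sqExp (norm_nonneg q) hq

lemma norm_summable_oblong {q : ℂ} (hq : ‖q‖ < 1) :
    Summable fun n : ℤ => ‖q ^ oblongExp n‖ := by
  simpa only [norm_pow] using summable_pow_oblongExp (norm_nonneg q) hq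

lemma hasSum_phiSeries {q : ℂ} (hq : ‖q‖ < 1) :
    HasSum (fun n : ℤ => q ^ sqExp n) (phiSeries q) :=
  (norm_summable_sq hq).of_norm.hasSum

lemma hasSum_psiSeries {q : ℂ} (hq : ‖q‖ < 1) :
    HasSum (fun n : ℤ => q ^ oblongExp n) (psiSeries q) :=
  (norm_summable_oblong hq).of_norm.hasSum

lemma phiSeries_zero : phiSeries 0 = 1 := by
  rw [phiSeries, tsum_eq_single 0]
  · simp [sqExp]
  · intro n hn
    rw [zero_pow]
    simp [sqExp, hn]

/-- Both n = 0 and n = -1 have exponent 0, and 0^0 = 1. -/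
lemma psiSeries_zero : psiSeries 0 = 2 := by
  rw [psiSeries, tsum_eq_sum (s := {0, -1})]
  · simp [oblongExp]; norm_num
  · intro n hn
    rw [zero_pow]
    simp only [Finset.mem_insert, Finset.mem_singleton, not_or] at hn
    simp [oblongExp, hn.1]
    omega

/-- The pairs of integers, split by the parity of their sum. -/
def pairParityEquiv : (ℤ × ℤ) ⊕ (ℤ × ℤ) ≃ ℤ × ℤ where
  toFun := Sum.elim (fun p => (p.1 + p.2, p.1 - p.2)) (fun p => (p.1 + p.2 + 1, p.1 - p.2))
  invFun p := if (p.1 + p.2) % 2 = 0 then .inl ((p.1 + p.2) / 2, (p.1 - p.2) / 2)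
    else .inr ((p.1 + p.2 - 1) / 2, (p.1 - p.2 - 1) / 2)
  left_inv := by
    rintro (⟨u, v⟩ | ⟨u, v⟩)
    · refine (if_pos (by simp only [Sum.elim_inl]; omega)).trans ?_
      simp only [Sum.elim_inl]
      congr 2 <;> omega
    · refine (if_neg (by simp only [Sum.elim_inr]; omega)).trans ?_
      simp only [Sum.elim_inr]
      congr 2 <;> omega
  right_inv := by
    rintro ⟨m, n⟩
    simp only
    split_ifs with h
    · simp only [Sum.elim_inl]
      ext <;> simp only <;> omega
    · simp only [Sum.elim_inr]
      ext <;> simp only <;> omega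

lemma hasSum_mul_of_norm {f g : ℤ → ℂ} {a b : ℂ} (hf : HasSum f a) (hg : HasSum g b)
    (hf' : Summable fun n => ‖f n‖) (hg' : Summable fun n => ‖g n‖) :
    HasSum (fun p : ℤ × ℤ => f p.1 * g p.2) (a * b) :=
  hf.mul hg (summable_mul_of_summable_norm hf' hg')

lemma norm_sq_lt_one {q : ℂ} (hq : ‖q‖ < 1) : ‖q ^ 2‖ < 1 := by
  rw [norm_pow]; exact pow_lt_one₀ (norm_nonneg q) hq two_ne_zero

/-- For m = u + v, n = u - v one has m² + n² = 2u² + 2v²; for m = u + v + 1, n = u - v it is 2u(u+1)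
+ 2v(v+1) + 1. -/
theorem phiSeries_sq {q : ℂ} (hq : ‖q‖ < 1) :
    phiSeries q ^ 2 = phiSeries (q ^ 2) ^ 2 + q * psiSeries (q ^ 2) ^ 2 := by
  have hq2 := norm_sq_lt_one hq
  have h := hasSum_mul_of_norm (hasSum_phiSeries hq) (hasSum_phiSeries hq)
    (norm_summable_sq hq) (norm_summable_sq hq)
  have h1 := hasSum_mul_of_norm (hasSum_phiSeries hq2) (hasSum_phiSeries hq2)
    (norm_summable_sq hq2) (norm_summable_sq hq2)
  have h2 := (hasSum_mul_of_norm (hasSum_psiSeries hq2) (hasSum_psiSeries hq2)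
    (norm_summable_oblong hq2) (norm_summable_oblong hq2)).mul_left q
  rw [← pairParityEquiv.hasSum_iff] at h
  rw [sq (phiSeries q), sq (phiSeries (q ^ 2)), sq (psiSeries (q ^ 2))]
  refine h.unique (HasSum.sum ?_ ?_)
  · refine h1.congr_fun fun p => ?_
    simp only [pairParityEquiv, Function.comp, Equiv.coe_fn_mk, Sum.elim_inl, ← pow_mul, ← pow_add]
    congr 1
    zify
    simp only [coe_sqExp]
    ring
  · refine h2.congr_fun fun p => ?_
    simp only [pairParityEquiv, Function.comp, Equiv.coe_fn_mk, Sum.elim_inr, ← pow_mul, ← pow_add,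
      ← pow_succ']
    congr 1
    zify
    simp only [coe_sqExp, coe_oblongExp]
    ring

/-- The same parity split. Even pairs give the exponent 2u(u+1) + 2v², odd pairs 2(u+1)² + 2v(v+1),
so the odd part needs a shift of u by one; the two parts are equal. -/
theorem psiSeries_sq {q : ℂ} (hq : ‖q‖ < 1) :
    psiSeries q ^ 2 = 2 * phiSeries (q ^ 2) * psiSeries (q ^ 2) := by
  have hq2 := norm_sq_lt_one hq
  have h := hasSum_mul_of_norm (hasSum_psiSeries hq) (hasSum_psiSeries hq)
    (norm_summable_oblong hq) (norm_summable_oblong hq)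
  have h1 := hasSum_mul_of_norm (hasSum_psiSeries hq2) (hasSum_phiSeries hq2)
    (norm_summable_oblong hq2) (norm_summable_sq hq2)
  have hs := ((Equiv.addRight (1 : ℤ)).hasSum_iff).2 (hasSum_phiSeries hq2)
  have hs' := ((Equiv.addRight (1 : ℤ)).summable_iff).2 (norm_summable_sq hq2)
  have h2 := hasSum_mul_of_norm hs (hasSum_psiSeries hq2) hs' (norm_summable_oblong hq2)
  rw [← pairParityEquiv.hasSum_iff] at h
  have e : 2 * phiSeries (q ^ 2) * psiSeries (q ^ 2) = psiSeries (q ^ 2) * phiSeries (q ^ 2) +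
      phiSeries (q ^ 2) * psiSeries (q ^ 2) := by ring
  rw [sq, e]
  refine h.unique (HasSum.sum ?_ ?_)
  · refine h1.congr_fun fun p => ?_
    simp only [pairParityEquiv, Function.comp, Equiv.coe_fn_mk, Sum.elim_inl, ← pow_mul, ← pow_add]
    congr 1
    zify
    simp only [coe_sqExp, coe_oblongExp]
    ring
  · refine h2.congr_fun fun p => ?_
    simp only [pairParityEquiv, Function.comp, Equiv.coe_fn_mk, Sum.elim_inr, ← pow_mul, ← pow_add,
      Equiv.coe_addRight]
    congr 1
    zify
    simp only [coe_sqExp, coe_oblongExp]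
    ring

lemma phiSeries_neg_sq {q : ℂ} (hq : ‖q‖ < 1) :
    phiSeries (-q) ^ 2 = phiSeries (q ^ 2) ^ 2 - q * psiSeries (q ^ 2) ^ 2 := by
  rw [phiSeries_sq (by rwa [norm_neg])]
  ring_nf

lemma psiSeries_neg (q : ℂ) : psiSeries (-q) = psiSeries q := by
  refine tsum_congr fun n => Even.neg_pow ?_ q
  rw [oblongExp, Int.natAbs_even]
  exact Int.even_mul_succ_self n

/-- Jacobi's quartic identity. The difference of the squares of φ(q)² and φ(-q)² is 4qφ(q²)²ψ(q²)²,
which is q times the square of ψ(q)². -/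
theorem phiSeries_pow_four {q : ℂ} (hq : ‖q‖ < 1) :
    phiSeries q ^ 4 = q * psiSeries q ^ 4 + phiSeries (-q) ^ 4 := by
  linear_combination (phiSeries q ^ 2 + (phiSeries (q ^ 2) ^ 2 + q * psiSeries (q ^ 2) ^ 2)) *
    phiSeries_sq hq - (phiSeries (-q) ^ 2 + (phiSeries (q ^ 2) ^ 2 - q * psiSeries (q ^ 2) ^ 2)) *
    phiSeries_neg_sq hq - q * (psiSeries q ^ 2 + 2 * phiSeries (q ^ 2) * psiSeries (q ^ 2)) *
    psiSeries_sq hq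

lemma phiSeries_mul_neg_sq {q : ℂ} (hq : ‖q‖ < 1) :
    (phiSeries q * phiSeries (-q)) ^ 2 = phiSeries (-q ^ 2) ^ 4 := by
  have h := phiSeries_pow_four (norm_sq_lt_one hq)
  rw [mul_pow, phiSeries_sq hq, phiSeries_neg_sq hq]
  linear_combination h

lemma continuousAt_phiSeries {q : ℂ} (hq : ‖q‖ < 1) : ContinuousAt phiSeries q :=
  (differentiableOn_phiSeries.differentiableAt
    (Metric.isOpen_ball.mem_nhds (mem_ball_zero_iff.2 hq))).continuousAt

lemma tendsto_pow_two_pow {q : ℂ} (hq : ‖q‖ < 1) :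
    Tendsto (fun n : ℕ => q ^ 2 ^ n) atTop (𝓝 0) :=
  (tendsto_pow_atTop_nhds_zero_of_norm_lt_one hq).comp
    (tendsto_pow_atTop_atTop_of_one_lt one_lt_two)

/-- A zero at q propagates through `phiSeries_mul_neg_sq` to zeros at -q^(2^(n+1)) for all n, and
these points tend to 0, where φ equals 1. No product formula is needed. -/
lemma phiSeries_ne_zero {q : ℂ} (hq : ‖q‖ < 1) : phiSeries q ≠ 0 := by
  intro h0
  have key : ∀ n : ℕ, phiSeries (-q ^ 2 ^ (n + 1)) = 0 := by
    intro n
    induction n with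
    | zero =>
      have h := phiSeries_mul_neg_sq hq
      rw [h0, zero_mul, zero_pow two_ne_zero] at h
      simpa using pow_eq_zero_iff (n := 4) (by norm_num) |>.1 h.symm
    | succ n ih =>
      have hq' : ‖q ^ 2 ^ (n + 1)‖ < 1 := by
        rw [norm_pow]; exact pow_lt_one₀ (norm_nonneg q) hq (by positivity)
      have h := phiSeries_mul_neg_sq hq'
      rw [ih, mul_zero, zero_pow two_ne_zero, ← pow_mul, ← pow_succ] at h
      exact pow_eq_zero_iff (n := 4) (by norm_num) |>.1 h.symm
  have ht : Tendsto (fun n : ℕ => phiSeries (-q ^ 2 ^ (n + 1))) atTop (𝓝 (phiSeries 0)) := by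
    refine (continuousAt_phiSeries (by simp)).tendsto.comp ?_
    simpa using ((tendsto_pow_two_pow hq).comp (tendsto_add_atTop_nat 1)).neg
  simp only [key, phiSeries_zero] at ht
  exact zero_ne_one (tendsto_nhds_unique tendsto_const_nhds ht)

lemma hasDerivAt_phiSeries {q : ℂ} (hq : ‖q‖ < 1) :
    HasDerivAt phiSeries (deriv phiSeries q) q :=
  (differentiableOn_phiSeries.differentiableAt
    (Metric.isOpen_ball.mem_nhds (mem_ball_zero_iff.2 hq))).hasDerivAt

lemma hasDerivAt_psiSeries {q : ℂ} (hq : ‖q‖ < 1) :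
    HasDerivAt psiSeries (deriv psiSeries q) q :=
  (differentiableOn_psiSeries.differentiableAt
    (Metric.isOpen_ball.mem_nhds (mem_ball_zero_iff.2 hq))).hasDerivAt

/-- Differentiating `phiSeries_sq` at 0 gives 2φ(0)φ'(0) = ψ(0)² = 4, without differentiating the
series. -/
lemma deriv_phiSeries_zero : deriv phiSeries 0 = 2 := by
  have h0 : ‖(0 : ℂ)‖ < 1 := by simp
  have hs : HasDerivAt (fun q : ℂ => q ^ 2) 0 0 := by simpa using hasDerivAt_pow 2 (0 : ℂ)
  have h1 := (hasDerivAt_phiSeries h0).fun_pow 2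
  have h2 : HasDerivAt (fun q : ℂ => phiSeries (q ^ 2)) 0 0 := by
    have h : HasDerivAt phiSeries (deriv phiSeries ((0 : ℂ) ^ 2)) ((0 : ℂ) ^ 2) :=
      hasDerivAt_phiSeries (by simp)
    exact (h.comp (0 : ℂ) hs).congr_deriv (mul_zero _)
  have h3 : HasDerivAt (fun q : ℂ => psiSeries (q ^ 2)) 0 0 := by
    have h : HasDerivAt psiSeries (deriv psiSeries ((0 : ℂ) ^ 2)) ((0 : ℂ) ^ 2) :=
      hasDerivAt_psiSeries (by simp)
    exact (h.comp (0 : ℂ) hs).congr_deriv (mul_zero _)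
  have h4 := (h2.fun_pow 2).fun_add ((hasDerivAt_id' (0 : ℂ)).fun_mul (h3.fun_pow 2))
  have h5 := h1.unique (h4.congr_of_eventuallyEq (by
    filter_upwards [Metric.isOpen_ball.mem_nhds (mem_ball_zero_iff.2 h0)] with q hq
    exact phiSeries_sq (mem_ball_zero_iff.1 hq)))
  norm_num [phiSeries_zero, psiSeries_zero] at h5
  linear_combination h5 / 2

end

/-! ### Reduction to a strip and a maximum principle for invariant norms. -/

section

open Filter Topology Complex

lemma im_neg_one_div (τ : ℂ) : (-1 / τ).im = τ.im / normSq τ := by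
  rw [neg_div, one_div, neg_im, inv_im, neg_div, neg_neg]

lemma im_neg_one_div_pos {τ : ℂ} (hτ : 0 < τ.im) : 0 < (-1 / τ).im := by
  rw [im_neg_one_div]
  exact div_pos hτ (normSq_pos.2 (by rintro rfl; simp at hτ))

lemma exists_add_int_re_le (τ : ℂ) : ∃ m : ℤ, |(τ + m).re| ≤ 1 / 2 :=
  ⟨-round τ.re, by simpa [sub_eq_add_neg] using abs_sub_round τ.re⟩

lemma apply_add_int_eq {X : Type*} {N : ℂ → X}
    (hT : ∀ τ : ℂ, 0 < τ.im → N (τ + 1) = N τ) {τ : ℂ} (hτ : 0 < τ.im) (m : ℤ) :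
    N (τ + m) = N τ := by
  induction m using Int.induction_on with
  | zero => simp
  | succ i ih =>
    rw [← ih, ← hT (τ + (i : ℤ)) (by simpa using hτ)]
    push_cast; ring_nf
  | pred i ih =>
    rw [← ih, ← hT (τ + ((-i - 1 : ℤ) : ℂ)) (by simpa using hτ)]
    push_cast; ring_nf

/-- Translations and the inversion move every point of the upper half plane into the half strip
`|Re τ| ≤ 1/2`, `Im τ ≥ 1/2`. -/
lemma exists_mem_strip {X : Type*} {N : ℂ → X}
    (hT : ∀ τ : ℂ, 0 < τ.im → N (τ + 1) = N τ) (hS : ∀ τ : ℂ, 0 < τ.im → N (-1 / τ) = N τ)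
    {τ : ℂ} (hτ : 0 < τ.im) :
    ∃ τ' : ℂ, |τ'.re| ≤ 1 / 2 ∧ 1 / 2 ≤ τ'.im ∧ N τ' = N τ := by
  have key : ∀ n : ℕ, ∀ τ : ℂ, (1 / 2 : ℝ) ^ (n + 1) ≤ τ.im →
      ∃ τ' : ℂ, |τ'.re| ≤ 1 / 2 ∧ 1 / 2 ≤ τ'.im ∧ N τ' = N τ := by
    intro n
    induction n with
    | zero =>
      intro τ h
      obtain ⟨m, hm⟩ := exists_add_int_re_le τ
      have h' : 1 / 2 ≤ τ.im := by simpa using h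
      exact ⟨τ + m, hm, by simpa using h', apply_add_int_eq hT (by linarith) m⟩
    | succ n ih =>
      intro τ h
      have hτ : 0 < τ.im := lt_of_lt_of_le (by positivity) h
      obtain ⟨m, hm⟩ := exists_add_int_re_le τ
      have hi : (τ + m).im = τ.im := by simp
      rcases le_or_gt (1 / 2) τ.im with h2 | h2
      · exact ⟨τ + m, hm, by rwa [hi], apply_add_int_eq hT hτ m⟩
      · have hpos : 0 < normSq (τ + m) :=
          normSq_pos.2 (by intro h0; rw [h0] at hi; simp at hi; linarith)
        -- With |Re| ≤ 1/2 and Im < 1/2 the squared modulus is at most 1/2, so inversion at least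
        -- doubles the imaginary part. This is why the induction runs over powers of 1/2.
        have hn : normSq (τ + m) ≤ 1 / 2 := by
          rw [normSq_apply, hi]
          nlinarith [abs_le.1 hm]
        obtain ⟨τ', h1, h3, h4⟩ := ih (-1 / (τ + m)) (by
          rw [im_neg_one_div, hi, le_div_iff₀ hpos]
          have : (1 / 2 : ℝ) ^ (n + 1 + 1) = (1 / 2) ^ (n + 1) * (1 / 2) := pow_succ _ _
          have h5 : (0 : ℝ) < (1 / 2) ^ (n + 1) := by positivity
          nlinarith)
        refine ⟨τ', h1, h3, ?_⟩
        rw [h4, hS _ (by rwa [hi]), apply_add_int_eq hT hτ m]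
  obtain ⟨n, hn⟩ := exists_pow_lt_of_lt_one hτ (by norm_num : (1 / 2 : ℝ) < 1)
  exact key n τ (by
    have h5 : (0 : ℝ) < (1 / 2) ^ n := by positivity
    rw [pow_succ]; linarith)

/-- A holomorphic vector valued function on the upper half plane that vanishes at `i∞` and whose
norm is invariant under `τ ↦ τ + 1` and `τ ↦ -1/τ` is zero. -/
theorem eq_zero_of_norm_invariant {E : Type*} [NormedAddCommGroup E] [NormedSpace ℂ E] {f : ℂ → E}
    (hd : DifferentiableOn ℂ f {τ | 0 < τ.im})
    (hT : ∀ τ : ℂ, 0 < τ.im → ‖f (τ + 1)‖ = ‖f τ‖)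
    (hS : ∀ τ : ℂ, 0 < τ.im → ‖f (-1 / τ)‖ = ‖f τ‖)
    (hf : Tendsto f (comap Complex.im atTop) (𝓝 0)) {τ₀ : ℂ} (hτ₀ : 0 < τ₀.im) : f τ₀ = 0 := by
  by_contra hne
  have ha : 0 < ‖f τ₀‖ := norm_pos_iff.2 hne
  have hev : ∀ᶠ τ in comap Complex.im atTop, ‖f τ‖ < ‖f τ₀‖ := by
    have := hf.norm
    rw [norm_zero] at this
    exact this.eventually_lt_const ha
  obtain ⟨Y, hY⟩ := (eventually_comap.1 hev).exists_forall_of_atTop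
  -- Above height Y the norm is smaller than ‖f τ₀‖, so a point with norm at least ‖f τ₀‖ can be
  -- moved into this compact rectangle. The maximum over the rectangle is then a global maximum.
  set K : Set ℂ := Set.Icc (-(1 / 2)) (1 / 2) ×ℂ Set.Icc (1 / 2) Y with hK
  have hred : ∀ τ : ℂ, 0 < τ.im → ‖f τ₀‖ ≤ ‖f τ‖ → ∃ τ' ∈ K, ‖f τ'‖ = ‖f τ‖ := by
    intro τ hτ hle
    obtain ⟨τ', h1, h2, h3⟩ := exists_mem_strip (N := fun τ => ‖f τ‖) hT hS hτ
    refine ⟨τ', ⟨abs_le.1 h1, h2, ?_⟩, h3⟩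
    by_contra! hlt
    have := hY τ'.im hlt.le τ' rfl
    linarith
  have hKH : K ⊆ {τ | 0 < τ.im} := fun τ hτ => lt_of_lt_of_le (by norm_num) hτ.2.1
  have hKc : IsCompact K := isCompact_Icc.reProdIm isCompact_Icc
  obtain ⟨τ₁, hτ₁, h1⟩ := hred τ₀ hτ₀ le_rfl
  obtain ⟨c, hcK, hc⟩ := hKc.exists_isMaxOn ⟨τ₁, hτ₁⟩ (hd.continuousOn.mono hKH).norm
  have hc0 : ‖f τ₀‖ ≤ ‖f c‖ := h1 ▸ hc hτ₁
  have hmax : IsMaxOn (norm ∘ f) {τ | 0 < τ.im} c := by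
    intro τ hτ
    change ‖f τ‖ ≤ ‖f c‖
    rcases le_total ‖f τ₀‖ ‖f τ‖ with h | h
    · obtain ⟨τ', h2, h3⟩ := hred τ hτ h
      exact h3 ▸ hc h2
    · exact h.trans hc0
  -- For vector values the maximum principle gives constancy of the norm only. That suffices: the
  -- norm at height max Y 1 would have to be at least ‖f τ₀‖.
  have hconst := Complex.norm_eqOn_of_isPreconnected_of_isMaxOn
    (convex_halfSpace_im_gt 0).isPreconnected (isOpen_lt continuous_const continuous_im)
    hd (hKH hcK) hmax
  have hbig : 0 < ((max Y 1 : ℝ) * I).im := by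
    simp
  have h2 := hconst hbig
  have h3 := hY ((max Y 1 : ℝ) * I).im (by simp) _ rfl
  simp only [Function.comp, Function.const] at h2
  linarith

end

/-! ### Theta functions on the upper half plane and the transformation of their logarithmic
derivatives. -/

section

open Filter Topology Complex

/-- The nome `q = exp (π i τ)`. -/
noncomputable def nome (τ : ℂ) : ℂ := cexp (π * I * τ)

/-- `θ₂(τ) = ∑ q^((n + 1/2)²)`. -/
noncomputable def jTheta2 (τ : ℂ) : ℂ := cexp (π * I * τ * (1 / 4)) * psiSeries (nome τ)

/-- `θ₃(τ) = ∑ q^(n²)`. -/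
noncomputable def jTheta3 (τ : ℂ) : ℂ := phiSeries (nome τ)

/-- `θ₄(τ) = ∑ (-1)^n q^(n²)`. -/
noncomputable def jTheta4 (τ : ℂ) : ℂ := phiSeries (-nome τ)

lemma norm_nome (τ : ℂ) : ‖nome τ‖ = Real.exp (-π * τ.im) := by
  simp [nome, norm_exp]

lemma norm_nome_lt_one {τ : ℂ} (hτ : 0 < τ.im) : ‖nome τ‖ < 1 := by
  rw [norm_nome, Real.exp_lt_one_iff]
  nlinarith [Real.pi_pos]

lemma nome_ne_zero (τ : ℂ) : nome τ ≠ 0 := exp_ne_zero _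

lemma nome_add_one (τ : ℂ) : nome (τ + 1) = -nome τ := by
  rw [nome, nome, mul_add, mul_one, exp_add, exp_pi_mul_I]; ring

lemma jTheta3_add_one (τ : ℂ) : jTheta3 (τ + 1) = jTheta4 τ := by
  rw [jTheta3, nome_add_one, jTheta4]

lemma jTheta4_add_one (τ : ℂ) : jTheta4 (τ + 1) = jTheta3 τ := by
  rw [jTheta3, jTheta4, nome_add_one, neg_neg]

lemma jTheta2_add_one (τ : ℂ) : jTheta2 (τ + 1) = cexp (π * I * (1 / 4)) * jTheta2 τ := by
  rw [jTheta2, jTheta2, nome_add_one, psiSeries_neg, ← mul_assoc, ← exp_add]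
  ring_nf

lemma jTheta2_add_one_pow_four (τ : ℂ) : jTheta2 (τ + 1) ^ 4 = -jTheta2 τ ^ 4 := by
  rw [jTheta2_add_one, mul_pow, ← exp_nat_mul]
  have : ((4 : ℕ) : ℂ) * (π * I * (1 / 4)) = π * I := by push_cast; ring
  rw [this, exp_pi_mul_I]; ring

lemma jTheta2_pow_four (τ : ℂ) : jTheta2 τ ^ 4 = nome τ * psiSeries (nome τ) ^ 4 := by
  rw [jTheta2, mul_pow, ← exp_nat_mul, nome]
  push_cast; ring_nf

theorem jTheta3_pow_four {τ : ℂ} (hτ : 0 < τ.im) :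
    jTheta3 τ ^ 4 = jTheta2 τ ^ 4 + jTheta4 τ ^ 4 := by
  rw [jTheta2_pow_four, jTheta3, jTheta4, phiSeries_pow_four (norm_nome_lt_one hτ)]

lemma jTheta3_ne_zero {τ : ℂ} (hτ : 0 < τ.im) : jTheta3 τ ≠ 0 :=
  phiSeries_ne_zero (norm_nome_lt_one hτ)

lemma jTheta4_ne_zero {τ : ℂ} (hτ : 0 < τ.im) : jTheta4 τ ≠ 0 :=
  phiSeries_ne_zero (by simpa using norm_nome_lt_one hτ)

/-- By `psiSeries_sq` and the non-vanishing of φ, a zero at q forces zeros at all q^(2^n), against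
ψ(0) = 2. -/
lemma psiSeries_ne_zero {q : ℂ} (hq : ‖q‖ < 1) : psiSeries q ≠ 0 := by
  intro h0
  have key : ∀ n : ℕ, psiSeries (q ^ 2 ^ n) = 0 := by
    intro n
    induction n with
    | zero => simpa using h0
    | succ n ih =>
      have hq' : ‖q ^ 2 ^ n‖ < 1 := by
        rw [norm_pow]; exact pow_lt_one₀ (norm_nonneg q) hq (by positivity)
      have h := psiSeries_sq hq'
      rw [ih, zero_pow two_ne_zero, ← pow_mul, ← pow_succ] at h
      have h2 := phiSeries_ne_zero (q := q ^ 2 ^ (n + 1)) (by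
        rw [norm_pow]; exact pow_lt_one₀ (norm_nonneg q) hq (by positivity))
      simpa [h2] using h.symm
  have ht : Tendsto (fun n : ℕ => psiSeries (q ^ 2 ^ n)) atTop (𝓝 (psiSeries 0)) :=
    (hasDerivAt_psiSeries (by simp)).continuousAt.tendsto.comp (tendsto_pow_two_pow hq)
  simp only [key, psiSeries_zero] at ht
  exact two_ne_zero (tendsto_nhds_unique tendsto_const_nhds ht).symm

lemma jTheta2_ne_zero {τ : ℂ} (hτ : 0 < τ.im) : jTheta2 τ ≠ 0 :=
  mul_ne_zero (exp_ne_zero _) (psiSeries_ne_zero (norm_nome_lt_one hτ))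

lemma natCast_sqExp (n : ℤ) : ((sqExp n : ℕ) : ℂ) = (n : ℂ) ^ 2 := by
  rw [← Int.cast_natCast, coe_sqExp]; push_cast; rfl

lemma natCast_oblongExp (n : ℤ) : ((oblongExp n : ℕ) : ℂ) = (n : ℂ) * (n + 1) := by
  rw [← Int.cast_natCast, coe_oblongExp]; push_cast; rfl

lemma jTheta3_eq (τ : ℂ) : jTheta3 τ = jacobiTheta₂ 0 τ := by
  refine tsum_congr fun n => ?_
  rw [nome, ← exp_nat_mul, natCast_sqExp, jacobiTheta₂_term]
  ring_nf

lemma jTheta2_eq (τ : ℂ) : jTheta2 τ = cexp (π * I * τ * (1 / 4)) * jacobiTheta₂ (τ / 2) τ := by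
  rw [jTheta2]
  congr 1
  refine tsum_congr fun n => ?_
  rw [nome, ← exp_nat_mul, natCast_oblongExp, jacobiTheta₂_term]
  ring_nf

lemma jTheta4_eq (τ : ℂ) : jTheta4 τ = jacobiTheta₂ (1 / 2) τ := by
  rw [← jTheta3_add_one, jTheta3]
  refine tsum_congr fun n => ?_
  rw [nome, ← exp_nat_mul, natCast_sqExp, jacobiTheta₂_term]
  -- The exponents differ by πi(n² - n), a multiple of 2πi: the signs (-1)^(n²) and (-1)^n agree.
  obtain ⟨k, hk⟩ := (Int.even_mul_pred_self n)
  have hk' : (n : ℂ) * (n - 1) = k + k := by exact_mod_cast congrArg (Int.cast : ℤ → ℂ) hk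
  rw [exp_eq_exp_iff_exists_int]
  refine ⟨k, ?_⟩
  linear_combination (π * I) * hk'

/-- The automorphy factor `(-iτ)^(1/2)`. -/
noncomputable def sFactor (τ : ℂ) : ℂ := (-I * τ) ^ (1 / 2 : ℂ)

lemma sFactor_sq (τ : ℂ) : sFactor τ ^ 2 = -I * τ := by
  rw [sFactor, ← cpow_nat_mul]; norm_num

lemma sFactor_ne_zero {τ : ℂ} (hτ : 0 < τ.im) : sFactor τ ≠ 0 := by
  intro h
  have := sFactor_sq τ
  rw [h] at this
  have h0 : τ = 0 := by simpa using this.symm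
  simp [h0] at hτ

lemma jTheta3_inv {τ : ℂ} (hτ : 0 < τ.im) : jTheta3 (-1 / τ) = sFactor τ * jTheta3 τ := by
  have hs := sFactor_ne_zero hτ
  rw [jTheta3_eq, jTheta3_eq, jacobiTheta₂_functional_equation 0 τ, ← sFactor]
  simp [hs]

lemma jTheta2_inv {τ : ℂ} (hτ : 0 < τ.im) : jTheta2 (-1 / τ) = sFactor τ * jTheta4 τ := by
  have hs := sFactor_ne_zero hτ
  have h : (1 : ℂ) / 2 / τ = -(-1 / τ / 2) := by ring
  rw [jTheta2_eq, jTheta4_eq, jacobiTheta₂_functional_equation (1 / 2) τ, ← sFactor, h,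
    jacobiTheta₂_neg_left]
  field_simp
  ring_nf

lemma jTheta4_inv {τ : ℂ} (hτ : 0 < τ.im) : jTheta4 (-1 / τ) = sFactor τ * jTheta2 τ := by
  have hs := sFactor_ne_zero hτ
  have h0 : τ ≠ 0 := by rintro rfl; simp at hτ
  have h : τ / 2 / τ = 1 / 2 := by field_simp
  have h2 : -π * I * (τ / 2) ^ 2 / τ = -(π * I * τ * (1 / 4)) := by field_simp; ring
  rw [jTheta2_eq, jTheta4_eq, jacobiTheta₂_functional_equation (τ / 2) τ, ← sFactor, h, h2, exp_neg]
  field_simp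

lemma isOpen_upperHalf : IsOpen {τ : ℂ | 0 < τ.im} := isOpen_lt continuous_const continuous_im

lemma upperHalf_mem_nhds {τ : ℂ} (hτ : 0 < τ.im) : {τ : ℂ | 0 < τ.im} ∈ 𝓝 τ :=
  isOpen_upperHalf.mem_nhds hτ

lemma hasDerivAt_nome (τ : ℂ) : HasDerivAt nome (π * I * nome τ) τ := by
  exact (((hasDerivAt_id' τ).const_mul (π * I : ℂ)).cexp).congr_deriv (by rw [nome]; ring)

/-- `D f = (πi)⁻¹ f' / f`. -/
noncomputable def logD (f : ℂ → ℂ) (τ : ℂ) : ℂ := deriv f τ / f τ / (π * I)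

/-- The quadratic differential expression `D(Df/f) - 2 (Df/f)²` with `D = (πi)⁻¹ d/dτ`. -/
noncomputable def logD₂ (f : ℂ → ℂ) (τ : ℂ) : ℂ := deriv (logD f) τ / (π * I) - 2 * logD f τ ^ 2

/-- Holomorphic without zeros on the upper half plane. -/
def IsUnitOnUpperHalf (f : ℂ → ℂ) : Prop :=
  DifferentiableOn ℂ f {τ | 0 < τ.im} ∧ ∀ τ : ℂ, 0 < τ.im → f τ ≠ 0

lemma IsUnitOnUpperHalf.hasDerivAt {f : ℂ → ℂ} (hf : IsUnitOnUpperHalf f) {τ : ℂ}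
    (hτ : 0 < τ.im) : HasDerivAt f (π * I * (logD f τ * f τ)) τ := by
  have h := (hf.1.differentiableAt (upperHalf_mem_nhds hτ)).hasDerivAt
  refine h.congr_deriv ?_
  have h1 := hf.2 τ hτ
  have h2 : (π : ℂ) ≠ 0 := by exact_mod_cast Real.pi_ne_zero
  rw [logD]
  field_simp

lemma IsUnitOnUpperHalf.differentiableOn_logD {f : ℂ → ℂ} (hf : IsUnitOnUpperHalf f) :
    DifferentiableOn ℂ (logD f) {τ | 0 < τ.im} :=
  ((hf.1.deriv isOpen_upperHalf).div hf.1 hf.2).div_const _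

lemma IsUnitOnUpperHalf.differentiableOn_logD₂ {f : ℂ → ℂ} (hf : IsUnitOnUpperHalf f) :
    DifferentiableOn ℂ (logD₂ f) {τ | 0 < τ.im} :=
  ((hf.differentiableOn_logD.deriv isOpen_upperHalf).div_const _).sub
    ((hf.differentiableOn_logD.pow 2).const_mul 2)

lemma IsUnitOnUpperHalf.hasDerivAt_logD {f : ℂ → ℂ} (hf : IsUnitOnUpperHalf f) {τ : ℂ}
    (hτ : 0 < τ.im) : HasDerivAt (logD f) (π * I * (logD₂ f τ + 2 * logD f τ ^ 2)) τ := by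
  have h := (hf.differentiableOn_logD.differentiableAt (upperHalf_mem_nhds hτ)).hasDerivAt
  refine h.congr_deriv ?_
  have h2 : (π : ℂ) ≠ 0 := by exact_mod_cast Real.pi_ne_zero
  rw [logD₂]
  field_simp
  ring

lemma logD_eq_of_hasDerivAt {f : ℂ → ℂ} {τ a : ℂ} (h : HasDerivAt f (π * I * (a * f τ)) τ)
    (h0 : f τ ≠ 0) : logD f τ = a := by
  have h2 : (π : ℂ) ≠ 0 := by exact_mod_cast Real.pi_ne_zero
  rw [logD, h.deriv]
  field_simp

lemma logD₂_eq_of_hasDerivAt {f : ℂ → ℂ} {τ a : ℂ}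
    (h : HasDerivAt (logD f) (π * I * a) τ) : logD₂ f τ = a - 2 * logD f τ ^ 2 := by
  have h2 : (π : ℂ) ≠ 0 := by exact_mod_cast Real.pi_ne_zero
  rw [logD₂, h.deriv]
  field_simp

lemma isUnitOnUpperHalf_jTheta3 : IsUnitOnUpperHalf jTheta3 :=
  ⟨fun τ hτ => ((hasDerivAt_phiSeries (norm_nome_lt_one hτ)).comp τ
    (hasDerivAt_nome τ)).differentiableAt.differentiableWithinAt, fun _ => jTheta3_ne_zero⟩

lemma isUnitOnUpperHalf_jTheta4 : IsUnitOnUpperHalf jTheta4 :=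
  ⟨fun τ hτ => ((hasDerivAt_phiSeries (by simpa using norm_nome_lt_one hτ)).comp τ
    (hasDerivAt_nome τ).fun_neg).differentiableAt.differentiableWithinAt, fun _ => jTheta4_ne_zero⟩

lemma isUnitOnUpperHalf_jTheta2 : IsUnitOnUpperHalf jTheta2 :=
  ⟨fun τ hτ => (DifferentiableAt.mul (a := fun τ : ℂ => cexp (π * I * τ * (1 / 4)))
    (b := fun τ => psiSeries (nome τ)) (by fun_prop)
    ((hasDerivAt_psiSeries (norm_nome_lt_one hτ)).comp τ
    (hasDerivAt_nome τ)).differentiableAt).differentiableWithinAt, fun _ => jTheta2_ne_zero⟩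

lemma logD_add_one {f g : ℂ → ℂ} {c : ℂ} (hc : c ≠ 0) (h : ∀ τ : ℂ, f (τ + 1) = c * g τ) (τ : ℂ) :
    logD f (τ + 1) = logD g τ := by
  have h1 := congrArg (fun F => deriv F τ) (funext h)
  simp only [deriv_comp_add_const, deriv_const_mul_field] at h1
  rw [logD, logD, h1, h, mul_div_mul_left _ _ hc]

lemma logD₂_add_one {f g : ℂ → ℂ} {c : ℂ} (hc : c ≠ 0) (h : ∀ τ : ℂ, f (τ + 1) = c * g τ) (τ : ℂ) :
    logD₂ f (τ + 1) = logD₂ g τ := by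
  have h1 := congrArg (fun F => deriv F τ) (funext (logD_add_one hc h))
  rw [deriv_comp_add_const] at h1
  rw [logD₂, logD₂, h1, logD_add_one hc h]

lemma hasDerivAt_neg_one_div {τ : ℂ} (hτ : τ ≠ 0) :
    HasDerivAt (fun τ : ℂ => -1 / τ) (1 / τ ^ 2) τ := by
  have := (hasDerivAt_inv hτ).const_mul (-1 : ℂ)
  simp only [← div_eq_mul_inv] at this
  exact this.congr_deriv (by ring)

lemma ne_zero_of_im_pos {τ : ℂ} (hτ : 0 < τ.im) : τ ≠ 0 := by
  rintro rfl; simp at hτ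

/-- The anomaly τ/(2πi) comes from the factor (-iτ)^(1/2) alone. It is the same for all three theta
functions, so it drops out of differences, which have weight 2. -/
lemma logD_inv {f g : ℂ → ℂ} (hf : IsUnitOnUpperHalf f) (hg : IsUnitOnUpperHalf g)
    (h : ∀ τ : ℂ, 0 < τ.im → f (-1 / τ) = sFactor τ * g τ) {τ : ℂ} (hτ : 0 < τ.im) :
    logD f (-1 / τ) = τ ^ 2 * logD g τ + τ * (1 / (2 * π * I)) := by
  have h0 := ne_zero_of_im_pos hτ
  have hπ : (π : ℂ) ≠ 0 := by exact_mod_cast Real.pi_ne_zero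
  -- Squaring replaces the square root by -iτ, so no branch has to be differentiated.
  have d1 := ((hf.hasDerivAt (im_neg_one_div_pos hτ)).comp τ (hasDerivAt_neg_one_div h0)).fun_pow 2
  have d2 := ((hasDerivAt_id' τ).const_mul (-I)).fun_mul ((hg.hasDerivAt hτ).fun_pow 2)
  have e := d1.unique (d2.congr_of_eventuallyEq (by
    filter_upwards [upperHalf_mem_nhds hτ] with w hw
    rw [Function.comp, h w hw, mul_pow, sFactor_sq]))
  have hs := sFactor_sq τ
  have hg0 := hg.2 τ hτ
  simp only [Function.comp, h τ hτ, Nat.cast_ofNat, Nat.add_one_sub_one, pow_one] at e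
  have e2 : (2 * π * I * logD f (-1 / τ)) * (sFactor τ ^ 2 * g τ ^ 2) =
      τ ^ 2 * (-I * g τ ^ 2 + -I * τ * (2 * (π * I) * logD g τ * g τ ^ 2)) := by
    field_simp at e ⊢
    linear_combination e
  rw [hs] at e2
  have e3 : -I * τ * g τ ^ 2 ≠ 0 := by simp [h0, hg0]
  apply mul_right_cancel₀ e3
  field_simp
  field_simp at e2
  linear_combination e2

/-- The coefficient 2 in `logD₂` is the one for which the anomalous terms 2τ³L/(πi) and τ²/(2(πi)²),
with L = `logD g τ`, cancel, leaving pure weight 4. -/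
lemma logD₂_inv {f g : ℂ → ℂ} (hf : IsUnitOnUpperHalf f) (hg : IsUnitOnUpperHalf g)
    (h : ∀ τ : ℂ, 0 < τ.im → f (-1 / τ) = sFactor τ * g τ) {τ : ℂ} (hτ : 0 < τ.im) :
    logD₂ f (-1 / τ) = τ ^ 4 * logD₂ g τ := by
  have h0 := ne_zero_of_im_pos hτ
  have hπ : (π : ℂ) ≠ 0 := by exact_mod_cast Real.pi_ne_zero
  have d1 := (hf.hasDerivAt_logD (im_neg_one_div_pos hτ)).comp τ (hasDerivAt_neg_one_div h0)
  have d2 := ((hasDerivAt_pow 2 τ).fun_mul (hg.hasDerivAt_logD hτ)).fun_add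
    ((hasDerivAt_id' τ).mul_const (1 / (2 * π * I)))
  have e := d1.unique (d2.congr_of_eventuallyEq (by
    filter_upwards [upperHalf_mem_nhds hτ] with w hw
    rw [Function.comp, logD_inv hf hg h hw]))
  rw [logD_inv hf hg h hτ] at e
  have hP : (π : ℂ) * I ≠ 0 := mul_ne_zero hπ I_ne_zero
  rw [mul_assoc 2 (π : ℂ) I] at e
  generalize (π : ℂ) * I = P at e hP
  simp only [Nat.cast_ofNat, Nat.add_one_sub_one, pow_one] at e
  field_simp at e
  refine mul_left_cancel₀ (mul_ne_zero two_ne_zero (pow_ne_zero 2 hP)) ?_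
  rw [neg_div]
  linear_combination e

end

/-! ### Expansions at i∞ and the differential identities for theta functions. -/

section

open Filter Topology Complex

lemma tendsto_nome : Tendsto nome (comap Complex.im atTop) (𝓝 0) := by
  rw [tendsto_zero_iff_norm_tendsto_zero]
  simp only [norm_nome]
  refine Real.tendsto_exp_atBot.comp ?_
  exact (tendsto_id.const_mul_atTop_of_neg (neg_lt_zero.2 Real.pi_pos)).comp tendsto_comap

lemma tendsto_of_eq_comp_nome {f G : ℂ → ℂ} (h : ∀ τ : ℂ, 0 < τ.im → f τ = G (nome τ))
    (hG : ContinuousAt G 0) (h0 : G 0 = 0) : Tendsto f (comap Complex.im atTop) (𝓝 0) := by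
  rw [← h0]
  refine (hG.tendsto.comp tendsto_nome).congr' ?_
  filter_upwards [tendsto_comap.eventually (eventually_gt_atTop (0 : ℝ))] with τ hτ
  exact (h τ hτ).symm

/-- Holomorphic without zeros on the unit disk. -/
def IsUnitOnDisk (g : ℂ → ℂ) : Prop :=
  DifferentiableOn ℂ g (Metric.ball 0 1) ∧ ∀ q : ℂ, ‖q‖ < 1 → g q ≠ 0

lemma ball_mem_nhds {q : ℂ} (hq : ‖q‖ < 1) : Metric.ball (0 : ℂ) 1 ∈ 𝓝 q :=
  Metric.isOpen_ball.mem_nhds (mem_ball_zero_iff.2 hq)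

lemma IsUnitOnDisk.differentiableOn_logDeriv {g : ℂ → ℂ} (hg : IsUnitOnDisk g) :
    DifferentiableOn ℂ (logDeriv g) (Metric.ball 0 1) :=
  (hg.1.deriv Metric.isOpen_ball).div hg.1 fun q hq => hg.2 q (mem_ball_zero_iff.1 hq)

lemma IsUnitOnDisk.continuousAt_logDeriv {g : ℂ → ℂ} (hg : IsUnitOnDisk g) :
    ContinuousAt (logDeriv g) 0 :=
  (hg.differentiableOn_logDeriv.differentiableAt (ball_mem_nhds (by simp))).continuousAt

lemma IsUnitOnDisk.continuousAt_deriv_logDeriv {g : ℂ → ℂ} (hg : IsUnitOnDisk g) :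
    ContinuousAt (deriv (logDeriv g)) 0 :=
  ((hg.differentiableOn_logDeriv.deriv Metric.isOpen_ball).differentiableAt
    (ball_mem_nhds (by simp))).continuousAt

lemma IsUnitOnDisk.continuousAt {g : ℂ → ℂ} (hg : IsUnitOnDisk g) : ContinuousAt g 0 :=
  (hg.1.differentiableAt (ball_mem_nhds (by simp))).continuousAt

section QExpansion

variable {f g : ℂ → ℂ} {a : ℂ} (hg : IsUnitOnDisk g)
  (hf : ∀ τ : ℂ, f τ = cexp (π * I * τ * a) * g (nome τ))

include hg hf

lemma logD_eq_logDeriv {τ : ℂ} (hτ : 0 < τ.im) :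
    logD f τ = a + nome τ * logDeriv g (nome τ) := by
  have hq := norm_nome_lt_one hτ
  have hg0 := hg.2 _ hq
  have d1 : HasDerivAt (fun τ : ℂ => cexp (π * I * τ * a)) (cexp (π * I * τ * a) * (π * I * a)) τ :=
    ((((hasDerivAt_id' τ).const_mul (π * I : ℂ)).mul_const a).cexp).congr_deriv (by ring)
  have d2 := d1.fun_mul (((hg.1.differentiableAt (ball_mem_nhds hq)).hasDerivAt).comp τ
    (hasDerivAt_nome τ))
  refine logD_eq_of_hasDerivAt ?_ (by rw [hf]; exact mul_ne_zero (exp_ne_zero _) hg0)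
  rw [funext hf]
  refine d2.congr_deriv ?_
  rw [logDeriv_apply, Function.comp]
  field_simp

/-- The constant term -2a² is -1/8 for θ₂, where a = 1/4, and 0 for θ₃ and θ₄, where a = 0. -/
lemma logD₂_eq_logDeriv {τ : ℂ} (hτ : 0 < τ.im) :
    logD₂ f τ = -2 * a ^ 2 + nome τ * (logDeriv g (nome τ) + nome τ * deriv (logDeriv g) (nome τ)
      - 4 * a * logDeriv g (nome τ) - 2 * nome τ * logDeriv g (nome τ) ^ 2) := by
  have hq := norm_nome_lt_one hτ
  have d1 := ((hasDerivAt_nome τ).fun_mul (((hg.differentiableOn_logDeriv.differentiableAt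
    (ball_mem_nhds hq)).hasDerivAt).comp τ (hasDerivAt_nome τ))).const_add a
  have d2 := d1.congr_of_eventuallyEq (f₁ := logD f) (by
    filter_upwards [upperHalf_mem_nhds hτ] with w hw
    rw [logD_eq_logDeriv hg hf hw, Function.comp])
  have d3 : HasDerivAt (logD f) (π * I * (nome τ * (logDeriv g (nome τ) +
      nome τ * deriv (logDeriv g) (nome τ)))) τ :=
    d2.congr_deriv (by rw [Function.comp]; ring)
  rw [logD₂_eq_of_hasDerivAt d3, logD_eq_logDeriv hg hf hτ]
  ring

end QExpansion

lemma isUnitOnDisk_phi : IsUnitOnDisk phiSeries :=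
  ⟨differentiableOn_phiSeries, fun _ => phiSeries_ne_zero⟩

lemma isUnitOnDisk_psi : IsUnitOnDisk psiSeries :=
  ⟨differentiableOn_psiSeries, fun _ => psiSeries_ne_zero⟩

lemma isUnitOnDisk_phi_neg : IsUnitOnDisk fun q => phiSeries (-q) :=
  ⟨differentiableOn_phiSeries.comp differentiable_neg.differentiableOn
    (fun q hq => by simpa using hq), fun q hq => phiSeries_ne_zero (by simpa using hq)⟩

lemma logDeriv_phi_zero : logDeriv phiSeries 0 = 2 := by
  rw [logDeriv_apply, deriv_phiSeries_zero, phiSeries_zero, div_one]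

lemma logDeriv_phi_neg_zero : logDeriv (fun q => phiSeries (-q)) 0 = -2 := by
  rw [logDeriv_apply, deriv_comp_neg]
  simp [deriv_phiSeries_zero, phiSeries_zero]

lemma jTheta2_qexp (τ : ℂ) : jTheta2 τ = cexp (π * I * τ * (1 / 4)) * psiSeries (nome τ) := rfl

lemma jTheta3_qexp (τ : ℂ) : jTheta3 τ = cexp (π * I * τ * 0) * phiSeries (nome τ) := by
  simp [jTheta3]

lemma jTheta4_qexp (τ : ℂ) :
    jTheta4 τ = cexp (π * I * τ * 0) * (fun q => phiSeries (-q)) (nome τ) := by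
  simp [jTheta4]

lemma jTheta4_add_one' (τ : ℂ) : jTheta4 (τ + 1) = 1 * jTheta3 τ := by
  rw [jTheta4_add_one, one_mul]

lemma jTheta3_add_one' (τ : ℂ) : jTheta3 (τ + 1) = 1 * jTheta4 τ := by
  rw [jTheta3_add_one, one_mul]

lemma sFactor_pow_four (τ : ℂ) : sFactor τ ^ 4 = -τ ^ 2 := by
  linear_combination (sFactor τ ^ 2 - I * τ) * sFactor_sq τ + τ ^ 2 * I_sq

lemma sFactor_mul_pow (τ a b : ℂ) :
    (sFactor τ * a * (sFactor τ * b)) ^ 4 = τ ^ 4 * (a * b) ^ 4 := by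
  linear_combination (sFactor τ ^ 4 - τ ^ 2) * (a * b) ^ 4 * sFactor_pow_four τ

/-- The obstructions to the first order theta identities. -/
noncomputable def halphenDefect (τ : ℂ) : ℂ × ℂ × ℂ :=
  ((logD jTheta3 τ - logD jTheta4 τ) / jTheta2 τ ^ 4 - 1 / 4,
   (logD jTheta2 τ - logD jTheta3 τ) / jTheta4 τ ^ 4 - 1 / 4,
   (logD jTheta2 τ - logD jTheta4 τ) / jTheta3 τ ^ 4 - 1 / 4)

/-- The obstructions to the second order theta identities. -/
noncomputable def quadraticDefect (τ : ℂ) : ℂ × ℂ × ℂ :=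
  (logD₂ jTheta2 τ / (jTheta3 τ * jTheta4 τ) ^ 4 + 1 / 8,
   logD₂ jTheta3 τ / (jTheta2 τ * jTheta4 τ) ^ 4 - 1 / 8,
   logD₂ jTheta4 τ / (jTheta2 τ * jTheta3 τ) ^ 4 + 1 / 8)

/-- The sign of θ₂⁴ under translation cancels the sign from exchanging θ₃ and θ₄. The coordinates
are quotients of weight 2 by weight 2, hence only permuted by translation and inversion, and the
maximum norm is preserved. -/
lemma halphenDefect_add_one (τ : ℂ) : halphenDefect (τ + 1) =
    ((halphenDefect τ).1, (halphenDefect τ).2.2, (halphenDefect τ).2.1) := by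
  simp only [halphenDefect, logD_add_one one_ne_zero jTheta3_add_one',
    logD_add_one one_ne_zero jTheta4_add_one', logD_add_one (exp_ne_zero _) jTheta2_add_one,
    jTheta2_add_one_pow_four, jTheta3_add_one, jTheta4_add_one]
  ext <;> simp only
  rw [div_neg]; ring

lemma halphenDefect_inv {τ : ℂ} (hτ : 0 < τ.im) : halphenDefect (-1 / τ) =
    ((halphenDefect τ).2.1, (halphenDefect τ).1, (halphenDefect τ).2.2) := by
  have h0 := ne_zero_of_im_pos hτ
  have h2 := jTheta2_ne_zero hτ
  have h3 := jTheta3_ne_zero hτ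
  have h4 := jTheta4_ne_zero hτ
  simp only [halphenDefect,
    logD_inv isUnitOnUpperHalf_jTheta3 isUnitOnUpperHalf_jTheta3 (fun _ => jTheta3_inv) hτ,
    logD_inv isUnitOnUpperHalf_jTheta2 isUnitOnUpperHalf_jTheta4 (fun _ => jTheta2_inv) hτ,
    logD_inv isUnitOnUpperHalf_jTheta4 isUnitOnUpperHalf_jTheta2 (fun _ => jTheta4_inv) hτ,
    jTheta2_inv hτ, jTheta3_inv hτ, jTheta4_inv hτ, mul_pow, sFactor_pow_four]
  ext <;> simp only <;> field_simp <;> ring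

/-- Here the coordinates are quotients of weight 4 by weight 4. The sign of θ₂⁴ survives in two of
them, which explains the alternating signs of the constants 1/8; the maximum norm does not see it.
-/
lemma quadraticDefect_add_one (τ : ℂ) : quadraticDefect (τ + 1) =
    ((quadraticDefect τ).1, -(quadraticDefect τ).2.2, -(quadraticDefect τ).2.1) := by
  simp only [quadraticDefect, logD₂_add_one one_ne_zero jTheta3_add_one',
    logD₂_add_one one_ne_zero jTheta4_add_one', logD₂_add_one (exp_ne_zero _) jTheta2_add_one,
    jTheta2_add_one_pow_four, jTheta3_add_one, jTheta4_add_one, mul_pow]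
  ext <;> simp only
  · ring
  · rw [neg_mul, div_neg]; ring
  · rw [neg_mul, div_neg]; ring

lemma quadraticDefect_inv {τ : ℂ} (hτ : 0 < τ.im) : quadraticDefect (-1 / τ) =
    ((quadraticDefect τ).2.2, (quadraticDefect τ).2.1, (quadraticDefect τ).1) := by
  have h0 := ne_zero_of_im_pos hτ
  have h2 := jTheta2_ne_zero hτ
  have h3 := jTheta3_ne_zero hτ
  have h4 := jTheta4_ne_zero hτ
  simp only [quadraticDefect,
    logD₂_inv isUnitOnUpperHalf_jTheta3 isUnitOnUpperHalf_jTheta3 (fun _ => jTheta3_inv) hτ,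
    logD₂_inv isUnitOnUpperHalf_jTheta2 isUnitOnUpperHalf_jTheta4 (fun _ => jTheta2_inv) hτ,
    logD₂_inv isUnitOnUpperHalf_jTheta4 isUnitOnUpperHalf_jTheta2 (fun _ => jTheta4_inv) hτ,
    jTheta2_inv hτ, jTheta3_inv hτ, jTheta4_inv hτ, sFactor_mul_pow]
  ext <;> simp only <;> field_simp

/-- In the first coordinate numerator and denominator both vanish to order one in q, and the limit
is (2 - (-2))/2⁴ = 1/4. In the other two, 1/4 is the leading exponent of θ₂. -/
lemma tendsto_halphenDefect :
    Tendsto halphenDefect (comap Complex.im atTop) (𝓝 0) := by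
  have cA := isUnitOnDisk_phi.continuousAt_logDeriv
  have cB := isUnitOnDisk_phi_neg.continuousAt_logDeriv
  have cC := isUnitOnDisk_psi.continuousAt_logDeriv
  have c3 := isUnitOnDisk_phi.continuousAt
  have c4 := isUnitOnDisk_phi_neg.continuousAt
  have c2 := isUnitOnDisk_psi.continuousAt
  have cq : ContinuousAt (fun q : ℂ => q) 0 := continuousAt_id
  refine Tendsto.prodMk_nhds ?_ (Tendsto.prodMk_nhds ?_ ?_)
  · refine tendsto_of_eq_comp_nome (G := fun q => (logDeriv phiSeries q -
      logDeriv (fun q => phiSeries (-q)) q) / psiSeries q ^ 4 - 1 / 4) (fun τ hτ => ?_) ?_ ?_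
    · rw [logD_eq_logDeriv isUnitOnDisk_phi jTheta3_qexp hτ,
        logD_eq_logDeriv isUnitOnDisk_phi_neg jTheta4_qexp hτ, jTheta2_pow_four]
      have h1 := nome_ne_zero τ
      have h2 := psiSeries_ne_zero (norm_nome_lt_one hτ)
      field_simp
      ring
    · exact ((cA.sub cB).div (c2.pow 4) (by simp [psiSeries_zero])).sub continuousAt_const
    · norm_num [logDeriv_phi_zero, logDeriv_phi_neg_zero, psiSeries_zero]
  · refine tendsto_of_eq_comp_nome (G := fun q => (1 / 4 + q * (logDeriv psiSeries q -
      logDeriv phiSeries q)) / phiSeries (-q) ^ 4 - 1 / 4) (fun τ hτ => ?_) ?_ ?_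
    · rw [logD_eq_logDeriv isUnitOnDisk_phi jTheta3_qexp hτ,
        logD_eq_logDeriv isUnitOnDisk_psi jTheta2_qexp hτ, jTheta4]
      ring
    · exact ((continuousAt_const.add (cq.mul (cC.sub cA))).div (c4.pow 4)
        (by simp [phiSeries_zero])).sub continuousAt_const
    · norm_num [phiSeries_zero]
  · refine tendsto_of_eq_comp_nome (G := fun q => (1 / 4 + q * (logDeriv psiSeries q -
      logDeriv (fun q => phiSeries (-q)) q)) / phiSeries q ^ 4 - 1 / 4) (fun τ hτ => ?_) ?_ ?_
    · rw [logD_eq_logDeriv isUnitOnDisk_phi_neg jTheta4_qexp hτ,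
        logD_eq_logDeriv isUnitOnDisk_psi jTheta2_qexp hτ, jTheta3]
      ring
    · exact ((continuousAt_const.add (cq.mul (cC.sub cB))).div (c3.pow 4)
        (by simp [phiSeries_zero])).sub continuousAt_const
    · norm_num [phiSeries_zero]

/-- The second factor of the `q`-expansion of `logD₂`. -/
noncomputable def logD₂Tail (a : ℂ) (g : ℂ → ℂ) (q : ℂ) : ℂ :=
  logDeriv g q + q * deriv (logDeriv g) q - 4 * a * logDeriv g q - 2 * q * logDeriv g q ^ 2

lemma IsUnitOnDisk.continuousAt_logD₂Tail {g : ℂ → ℂ} (hg : IsUnitOnDisk g) (a : ℂ) :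
    ContinuousAt (logD₂Tail a g) 0 := by
  have c1 := hg.continuousAt_logDeriv
  have c2 := hg.continuousAt_deriv_logDeriv
  have cq : ContinuousAt (fun q : ℂ => q) 0 := continuousAt_id
  exact ((c1.add (cq.mul c2)).sub (continuousAt_const.mul c1)).sub
    ((continuousAt_const.mul cq).mul (c1.pow 2))

/-- The limits of the three quotients are -2(1/4)² = -1/8, 2/2⁴ = 1/8 and -2/2⁴ = -1/8; in the last
two a factor q cancels against θ₂⁴. -/
lemma tendsto_quadraticDefect :
    Tendsto quadraticDefect (comap Complex.im atTop) (𝓝 0) := by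
  have cA := isUnitOnDisk_phi.continuousAt_logD₂Tail 0
  have cB := isUnitOnDisk_phi_neg.continuousAt_logD₂Tail 0
  have cC := isUnitOnDisk_psi.continuousAt_logD₂Tail (1 / 4)
  have c3 := isUnitOnDisk_phi.continuousAt
  have c4 := isUnitOnDisk_phi_neg.continuousAt
  have c2 := isUnitOnDisk_psi.continuousAt
  have cq : ContinuousAt (fun q : ℂ => q) 0 := continuousAt_id
  refine Tendsto.prodMk_nhds ?_ (Tendsto.prodMk_nhds ?_ ?_)
  · refine tendsto_of_eq_comp_nome (G := fun q => (-1 / 8 + q * logD₂Tail (1 / 4) psiSeries q) /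
      (phiSeries q * phiSeries (-q)) ^ 4 + 1 / 8) (fun τ hτ => ?_) ?_ ?_
    · rw [logD₂_eq_logDeriv isUnitOnDisk_psi jTheta2_qexp hτ, jTheta3, jTheta4, logD₂Tail]
      ring
    · exact ((continuousAt_const.add (cq.mul cC)).div ((c3.mul c4).pow 4)
        (by simp [phiSeries_zero])).add continuousAt_const
    · norm_num [phiSeries_zero]
  · refine tendsto_of_eq_comp_nome (G := fun q => logD₂Tail 0 phiSeries q /
      (psiSeries q * phiSeries (-q)) ^ 4 - 1 / 8) (fun τ hτ => ?_) ?_ ?_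
    · rw [logD₂_eq_logDeriv isUnitOnDisk_phi jTheta3_qexp hτ, mul_pow, jTheta2_pow_four, jTheta4,
        logD₂Tail]
      have h1 := nome_ne_zero τ
      have h2 := psiSeries_ne_zero (norm_nome_lt_one hτ)
      have h3 := isUnitOnDisk_phi_neg.2 _ (norm_nome_lt_one hτ)
      field_simp
      ring
    · exact (cA.div ((c2.mul c4).pow 4)
        (by simp [phiSeries_zero, psiSeries_zero])).sub continuousAt_const
    · norm_num [phiSeries_zero, psiSeries_zero, logD₂Tail, logDeriv_phi_zero]
  · refine tendsto_of_eq_comp_nome (G := fun q => logD₂Tail 0 (fun q => phiSeries (-q)) q /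
      (psiSeries q * phiSeries q) ^ 4 + 1 / 8) (fun τ hτ => ?_) ?_ ?_
    · rw [logD₂_eq_logDeriv isUnitOnDisk_phi_neg jTheta4_qexp hτ, mul_pow, jTheta2_pow_four,
        jTheta3, logD₂Tail]
      have h1 := nome_ne_zero τ
      have h2 := psiSeries_ne_zero (norm_nome_lt_one hτ)
      have h3 := isUnitOnDisk_phi.2 _ (norm_nome_lt_one hτ)
      field_simp
      ring
    · exact (cB.div ((c2.mul c3).pow 4)
        (by simp [phiSeries_zero, psiSeries_zero])).add continuousAt_const
    · norm_num [phiSeries_zero, psiSeries_zero, logD₂Tail, logDeriv_phi_neg_zero]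

lemma halphenDefect_eq_zero {τ : ℂ} (hτ : 0 < τ.im) : halphenDefect τ = 0 := by
  have u2 := isUnitOnUpperHalf_jTheta2
  have u3 := isUnitOnUpperHalf_jTheta3
  have u4 := isUnitOnUpperHalf_jTheta4
  refine eq_zero_of_norm_invariant ?_ (fun τ _ => ?_) (fun τ hτ => ?_) tendsto_halphenDefect hτ
  · refine DifferentiableOn.prodMk ?_ (DifferentiableOn.prodMk ?_ ?_)
    · exact ((u3.differentiableOn_logD.sub u4.differentiableOn_logD).div (u2.1.pow 4)
        fun τ hτ => pow_ne_zero 4 (u2.2 τ hτ)).sub_const _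
    · exact ((u2.differentiableOn_logD.sub u3.differentiableOn_logD).div (u4.1.pow 4)
        fun τ hτ => pow_ne_zero 4 (u4.2 τ hτ)).sub_const _
    · exact ((u2.differentiableOn_logD.sub u4.differentiableOn_logD).div (u3.1.pow 4)
        fun τ hτ => pow_ne_zero 4 (u3.2 τ hτ)).sub_const _
  · rw [halphenDefect_add_one]
    simp only [Prod.norm_def]
    rw [max_comm ‖(halphenDefect τ).2.2‖]
  · rw [halphenDefect_inv hτ]
    simp only [Prod.norm_def]
    exact max_left_comm _ _ _

lemma quadraticDefect_eq_zero {τ : ℂ} (hτ : 0 < τ.im) : quadraticDefect τ = 0 := by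
  have u2 := isUnitOnUpperHalf_jTheta2
  have u3 := isUnitOnUpperHalf_jTheta3
  have u4 := isUnitOnUpperHalf_jTheta4
  refine eq_zero_of_norm_invariant ?_ (fun τ _ => ?_) (fun τ hτ => ?_) tendsto_quadraticDefect hτ
  · refine DifferentiableOn.prodMk ?_ (DifferentiableOn.prodMk ?_ ?_)
    · exact (u2.differentiableOn_logD₂.div ((u3.1.mul u4.1).pow 4)
        fun τ hτ => pow_ne_zero 4 (mul_ne_zero (u3.2 τ hτ) (u4.2 τ hτ))).add_const _
    · exact (u3.differentiableOn_logD₂.div ((u2.1.mul u4.1).pow 4)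
        fun τ hτ => pow_ne_zero 4 (mul_ne_zero (u2.2 τ hτ) (u4.2 τ hτ))).sub_const _
    · exact (u4.differentiableOn_logD₂.div ((u2.1.mul u3.1).pow 4)
        fun τ hτ => pow_ne_zero 4 (mul_ne_zero (u2.2 τ hτ) (u3.2 τ hτ))).add_const _
  · rw [quadraticDefect_add_one]
    simp only [Prod.norm_def, norm_neg]
    rw [max_comm ‖(quadraticDefect τ).2.2‖]
  · rw [quadraticDefect_inv hτ]
    simp only [Prod.norm_def]
    rw [max_left_comm, max_comm ‖(quadraticDefect τ).2.2‖, max_left_comm]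

theorem logD_jTheta4 {τ : ℂ} (hτ : 0 < τ.im) :
    logD jTheta4 τ = logD jTheta3 τ - jTheta2 τ ^ 4 / 4 := by
  have h := congrArg Prod.fst (halphenDefect_eq_zero hτ)
  have h2 := jTheta2_ne_zero hτ
  simp only [halphenDefect, Prod.fst_zero] at h
  field_simp at h
  linear_combination -h / 4

theorem logD_jTheta2 {τ : ℂ} (hτ : 0 < τ.im) :
    logD jTheta2 τ = logD jTheta3 τ + jTheta4 τ ^ 4 / 4 := by
  have h := congrArg (fun p => p.2.1) (halphenDefect_eq_zero hτ)
  have h2 := jTheta4_ne_zero hτ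
  simp only [halphenDefect, Prod.fst_zero, Prod.snd_zero] at h
  field_simp at h
  linear_combination h / 4

theorem logD₂_jTheta3 {τ : ℂ} (hτ : 0 < τ.im) :
    logD₂ jTheta3 τ = jTheta2 τ ^ 4 * jTheta4 τ ^ 4 / 8 := by
  have h := congrArg (fun p => p.2.1) (quadraticDefect_eq_zero hτ)
  have h2 := jTheta2_ne_zero hτ
  have h4 := jTheta4_ne_zero hτ
  simp only [quadraticDefect, Prod.fst_zero, Prod.snd_zero] at h
  field_simp at h
  linear_combination h / 8

end

/-! ### Elliptic integrals, the arithmetic-geometric mean and the lemniscatic case. -/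

section

open Filter Topology MeasureTheory Set

/-- The complete elliptic integral `∫₀^∞ dt / √((t² + a²)(t² + b²))`. -/
noncomputable def ellipticI (a b : ℝ) : ℝ :=
  ∫ t in Ioi (0 : ℝ), 1 / √((t ^ 2 + a ^ 2) * (t ^ 2 + b ^ 2))

lemma injOn_landen {r : ℝ} (hr : 0 < r) : InjOn (fun t : ℝ => (t - r / t) / 2) (Ioi 0) := by
  intro s (hs : 0 < s) t (ht : 0 < t) h
  have h1 : (s - t) * (s * t + r) = 0 := by
    simp only at h
    field_simp at h
    linear_combination h
  have h2 : s * t + r ≠ 0 := by positivity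
  linarith [(mul_eq_zero.1 h1).resolve_right h2]

lemma image_landen {r : ℝ} (hr : 0 < r) : (fun t : ℝ => (t - r / t) / 2) '' Ioi 0 = univ := by
  refine eq_univ_of_forall fun u => ?_
  have h0 : 0 ≤ u ^ 2 + r := by positivity
  have h1 : |u| < √(u ^ 2 + r) := by
    rw [← Real.sqrt_sq_eq_abs]
    exact Real.sqrt_lt_sqrt (sq_nonneg u) (by linarith)
  have h2 : 0 < u + √(u ^ 2 + r) := by linarith [neg_abs_le u]
  refine ⟨u + √(u ^ 2 + r), h2, ?_⟩
  simp only
  field_simp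
  linear_combination Real.sq_sqrt h0

lemma hasDerivAt_landen (r : ℝ) {t : ℝ} (ht : t ≠ 0) :
    HasDerivAt (fun t : ℝ => (t - r / t) / 2) ((t ^ 2 + r) / (2 * t ^ 2)) t := by
  have h := ((hasDerivAt_id' t).sub ((hasDerivAt_inv ht).const_mul r)).div_const 2
  simp only [← div_eq_mul_inv] at h
  refine h.congr_deriv ?_
  field_simp
  ring

/-- The quadratic transformation of elliptic integrals. -/
lemma integral_landen (p : ℝ) {r : ℝ} (hr : 0 < r) :
    ∫ t in Ioi (0 : ℝ), 1 / √(t ^ 4 + p * t ^ 2 + r ^ 2) =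
      ∫ u in Ioi (0 : ℝ), 1 / √((u ^ 2 + (p + 2 * r) / 4) * (u ^ 2 + r)) := by
  set h : ℝ → ℝ := fun u => 1 / √((u ^ 2 + (p + 2 * r) / 4) * (u ^ 2 + r)) with hh
  -- The substitution u = (t - r/t)/2 maps the half line onto the whole line, and the integrand in u
  -- is even.
  have h1 : ∫ u, h u = 2 * ∫ u in Ioi (0 : ℝ), h u := by
    rw [← integral_comp_abs]
    simp only [hh, sq_abs]
  have h2 := integral_image_eq_integral_abs_deriv_smul measurableSet_Ioi
    (fun t ht => (hasDerivAt_landen r (ne_of_gt ht)).hasDerivWithinAt) (injOn_landen hr) h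
  rw [image_landen hr, setIntegral_univ, h1] at h2
  have h3 : ∫ t in Ioi (0 : ℝ), |(t ^ 2 + r) / (2 * t ^ 2)| • h ((t - r / t) / 2) =
      ∫ t in Ioi (0 : ℝ), 2 * (1 / √(t ^ 4 + p * t ^ 2 + r ^ 2)) := by
    refine setIntegral_congr_fun measurableSet_Ioi fun t (ht : 0 < t) => ?_
    have hc : 0 < (t ^ 2 + r) / (4 * t ^ 2) := by positivity
    -- The second factor is the perfect square ((t + r/t)/2)², and the constant (p + 2r)/4 turns the
    -- first into (t⁴ + pt² + r²)/(4t²).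
    have e : (((t - r / t) / 2) ^ 2 + (p + 2 * r) / 4) * (((t - r / t) / 2) ^ 2 + r) =
        ((t ^ 2 + r) / (4 * t ^ 2)) ^ 2 * (t ^ 4 + p * t ^ 2 + r ^ 2) := by
      field_simp; ring
    simp only [hh]
    rw [e, Real.sqrt_mul (sq_nonneg _), Real.sqrt_sq hc.le, abs_of_pos (by positivity), smul_eq_mul,
      one_div, one_div, mul_inv, ← mul_assoc]
    congr 1
    field_simp
    ring
  rw [h3, integral_const_mul] at h2
  linarith

/-- The Landen substitution with p = a² + b² and r = ab, for which (p + 2r)/4 is the square of the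
arithmetic mean. -/
lemma ellipticI_agm {a b a' b' : ℝ} (hab : 0 < a * b) (h1 : 2 * a' = a + b)
    (h2 : b' ^ 2 = a * b) : ellipticI a b = ellipticI a' b' := by
  have h := integral_landen (a ^ 2 + b ^ 2) hab
  have e1 : (a ^ 2 + b ^ 2 + 2 * (a * b)) / 4 = a' ^ 2 := by
    have : a' = (a + b) / 2 := by linarith
    rw [this]; ring
  rw [e1, ← h2] at h
  rw [ellipticI, ellipticI, ← h]
  refine setIntegral_congr_fun measurableSet_Ioi fun t _ => ?_
  rw [h2]
  ring_nf

/-- The same substitution with p = 0 and r = 1. -/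
lemma ellipticI_lemniscate {b : ℝ} (hb : 2 * b ^ 2 = 1) :
    ellipticI 1 b = ∫ t in Ioi (0 : ℝ), 1 / √(t ^ 4 + 1) := by
  have h := integral_landen 0 one_pos
  have e : b ^ 2 = (0 + 2 * 1) / 4 := by linarith
  simp only [zero_mul, add_zero, one_pow] at h
  rw [h, ellipticI]
  refine setIntegral_congr_fun measurableSet_Ioi fun t _ => ?_
  rw [e, one_pow, mul_comm]

lemma ellipticI_smul {c : ℝ} (hc : 0 < c) (a b : ℝ) :
    ellipticI (c * a) (c * b) = c⁻¹ * ellipticI a b := by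
  have h := integral_comp_mul_left_Ioi
    (fun t => 1 / √((t ^ 2 + (c * a) ^ 2) * (t ^ 2 + (c * b) ^ 2))) 0 hc
  rw [mul_zero, smul_eq_mul] at h
  have h2 : ∫ t in Ioi (0 : ℝ), 1 / √(((c * t) ^ 2 + (c * a) ^ 2) * ((c * t) ^ 2 + (c * b) ^ 2)) =
      ∫ t in Ioi (0 : ℝ), (c ^ 2)⁻¹ * (1 / √((t ^ 2 + a ^ 2) * (t ^ 2 + b ^ 2))) := by
    refine setIntegral_congr_fun measurableSet_Ioi fun t _ => ?_
    have e : ((c * t) ^ 2 + (c * a) ^ 2) * ((c * t) ^ 2 + (c * b) ^ 2) =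
      (c ^ 2) ^ 2 * ((t ^ 2 + a ^ 2) * (t ^ 2 + b ^ 2)) := by ring
    rw [e, Real.sqrt_mul (by positivity), Real.sqrt_sq (by positivity), one_div, one_div, mul_inv]
  rw [h2, integral_const_mul] at h
  rw [ellipticI, ellipticI]
  field_simp at h ⊢
  exact h.symm

lemma scaled_one_add_sq_le {t c a : ℝ} (hc : 0 < c) (h1 : c ≤ 1) (ha : c ≤ a) :
    c ^ 2 * (1 + t ^ 2) ≤ t ^ 2 + a ^ 2 := by
  have h2 : c ^ 2 ≤ 1 := pow_le_one₀ hc.le h1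
  have h3 : c ^ 2 ≤ a ^ 2 := pow_le_pow_left₀ hc.le ha 2
  nlinarith [mul_nonneg (sq_nonneg t) (sub_nonneg.2 h2)]

lemma le_scaled_one_add_sq {t c a : ℝ} (ha0 : 0 < a) (h1 : 1 ≤ c) (ha : a ≤ c) :
    t ^ 2 + a ^ 2 ≤ c ^ 2 * (1 + t ^ 2) := by
  have h2 : 1 ≤ c ^ 2 := one_le_pow₀ h1
  have h3 : a ^ 2 ≤ c ^ 2 := pow_le_pow_left₀ ha0.le ha 2
  nlinarith [mul_nonneg (sq_nonneg t) (sub_nonneg.2 h2)]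

lemma sqrt_bound_aux {t c a b : ℝ} (hc : 0 < c) (ha : c ^ 2 * (1 + t ^ 2) ≤ t ^ 2 + a ^ 2)
    (hb : c ^ 2 * (1 + t ^ 2) ≤ t ^ 2 + b ^ 2) :
    1 / √((t ^ 2 + a ^ 2) * (t ^ 2 + b ^ 2)) ≤ (c ^ 2)⁻¹ * (1 + t ^ 2)⁻¹ := by
  rw [← mul_inv, one_div]
  refine inv_anti₀ (by positivity) (Real.le_sqrt_of_sq_le ?_)
  rw [sq (c ^ 2 * (1 + t ^ 2))]
  exact mul_le_mul ha hb (by positivity) (by positivity)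

lemma sqrt_bound_aux' {t c a b : ℝ} (hc : 0 < c) (ha0 : 0 < a) (hb0 : 0 < b)
    (ha : t ^ 2 + a ^ 2 ≤ c ^ 2 * (1 + t ^ 2)) (hb : t ^ 2 + b ^ 2 ≤ c ^ 2 * (1 + t ^ 2)) :
    (c ^ 2)⁻¹ * (1 + t ^ 2)⁻¹ ≤ 1 / √((t ^ 2 + a ^ 2) * (t ^ 2 + b ^ 2)) := by
  rw [← mul_inv, one_div]
  refine inv_anti₀ (Real.sqrt_pos.2 (by positivity)) (Real.sqrt_le_iff.2 ⟨by positivity, ?_⟩)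
  rw [sq (c ^ 2 * (1 + t ^ 2))]
  exact mul_le_mul ha hb (by positivity) (by positivity)

lemma integral_inv_one_add_sq_Ioi_zero (c : ℝ) :
    ∫ t in Ioi (0 : ℝ), (c ^ 2)⁻¹ * (1 + t ^ 2)⁻¹ = (c ^ 2)⁻¹ * (π / 2) := by
  rw [integral_const_mul, integral_Ioi_inv_one_add_sq, Real.arctan_zero, sub_zero]

lemma integrableOn_ellipticI {a b : ℝ} (ha : 0 < a) (hb : 0 < b) :
    IntegrableOn (fun t : ℝ => 1 / √((t ^ 2 + a ^ 2) * (t ^ 2 + b ^ 2))) (Ioi 0) := by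
  set c := min 1 (min a b) with hc
  have hc0 : 0 < c := lt_min one_pos (lt_min ha hb)
  have h1 : c ≤ 1 := min_le_left _ _
  have h2 : c ≤ a := (min_le_right _ _).trans (min_le_left _ _)
  have h3 : c ≤ b := (min_le_right _ _).trans (min_le_right _ _)
  refine Integrable.mono' (integrable_inv_one_add_sq.integrableOn.const_mul ((c ^ 2)⁻¹)) ?_ ?_
  · refine (Continuous.aestronglyMeasurable ?_)
    refine continuous_const.div (by fun_prop) fun t => (Real.sqrt_pos.2 (by positivity)).ne'
  · refine ae_of_all _ fun t => ?_
    rw [Real.norm_of_nonneg (by positivity)]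
    exact sqrt_bound_aux hc0 (scaled_one_add_sq_le hc0 h1 h2) (scaled_one_add_sq_le hc0 h1 h3)

lemma ellipticI_le {a b c : ℝ} (hc : 0 < c) (h1 : c ≤ 1) (ha : c ≤ a) (hb : c ≤ b) :
    ellipticI a b ≤ (c ^ 2)⁻¹ * (π / 2) := by
  rw [← integral_inv_one_add_sq_Ioi_zero]
  refine setIntegral_mono_on (integrableOn_ellipticI (by linarith) (by linarith))
    (integrable_inv_one_add_sq.integrableOn.const_mul _) measurableSet_Ioi fun t _ => ?_
  exact sqrt_bound_aux hc (scaled_one_add_sq_le hc h1 ha) (scaled_one_add_sq_le hc h1 hb)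

lemma le_ellipticI {a b c : ℝ} (ha0 : 0 < a) (hb0 : 0 < b) (h1 : 1 ≤ c) (ha : a ≤ c) (hb : b ≤ c) :
    (c ^ 2)⁻¹ * (π / 2) ≤ ellipticI a b := by
  rw [← integral_inv_one_add_sq_Ioi_zero]
  refine setIntegral_mono_on (integrable_inv_one_add_sq.integrableOn.const_mul _)
    (integrableOn_ellipticI ha0 hb0) measurableSet_Ioi fun t _ => ?_
  exact sqrt_bound_aux' (by linarith) ha0 hb0 (le_scaled_one_add_sq ha0 h1 ha)
    (le_scaled_one_add_sq hb0 h1 hb)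

/-- If the arithmetic-geometric mean iteration tends to `1`, the elliptic integral is `π / 2`. -/
lemma ellipticI_eq_of_tendsto {a b : ℕ → ℝ} (ha : ∀ n, 0 < a n) (hb : ∀ n, 0 < b n)
    (h1 : ∀ n, 2 * a (n + 1) = a n + b n) (h2 : ∀ n, b (n + 1) ^ 2 = a n * b n)
    (hta : Tendsto a atTop (𝓝 1)) (htb : Tendsto b atTop (𝓝 1)) :
    ellipticI (a 0) (b 0) = π / 2 := by
  have hconst : ∀ n, ellipticI (a n) (b n) = ellipticI (a 0) (b 0) := by
    intro n
    induction n with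
    | zero => rfl
    | succ n ih => rw [← ih, ellipticI_agm (mul_pos (ha n) (hb n)) (h1 n) (h2 n)]
  have hlim : ∀ f : ℕ → ℝ, Tendsto f atTop (𝓝 1) →
      Tendsto (fun n => (f n ^ 2)⁻¹ * (π / 2)) atTop (𝓝 (π / 2)) := by
    intro f hf
    have := ((hf.pow 2).inv₀ (by norm_num)).mul_const (π / 2)
    simpa using this
  -- The integral is constant along the iteration and lies between c⁻²π/2 for c the maximum and for
  -- c the minimum of 1, a n, b n. This squeeze replaces continuity of the integral in its
  -- parameters.
  have hmin : Tendsto (fun n => min 1 (min (a n) (b n))) atTop (𝓝 1) := by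
    simpa using (tendsto_const_nhds (x := (1 : ℝ))).min (hta.min htb)
  have hmax : Tendsto (fun n => max 1 (max (a n) (b n))) atTop (𝓝 1) := by
    simpa using (tendsto_const_nhds (x := (1 : ℝ))).max (hta.max htb)
  refine le_antisymm (ge_of_tendsto' (hlim _ hmin) fun n => ?_)
    (le_of_tendsto' (hlim _ hmax) fun n => ?_)
  · rw [← hconst n]
    exact ellipticI_le (lt_min one_pos (lt_min (ha n) (hb n))) (min_le_left _ _)
      ((min_le_right _ _).trans (min_le_left _ _)) ((min_le_right _ _).trans (min_le_right _ _))
  · rw [← hconst n]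
    exact le_ellipticI (ha n) (hb n) (le_max_left _ _)
      ((le_max_left _ _).trans (le_max_right _ _)) ((le_max_right _ _).trans (le_max_right _ _))

lemma beta_eq_integral {u v : ℝ} (hu : 0 < u) (hv : 0 < v) :
    ProbabilityTheory.beta u v = ∫ x in Ioo (0 : ℝ) 1, x ^ (u - 1) * (1 - x) ^ (v - 1) := by
  rw [ProbabilityTheory.beta_eq_betaIntegralReal u v hu hv, Complex.betaIntegral,
    intervalIntegral.integral_of_le zero_le_one, integral_Ioc_eq_integral_Ioo]
  have : ∀ x ∈ Ioo (0 : ℝ) 1, (x : ℂ) ^ ((u : ℂ) - 1) * (1 - (x : ℂ)) ^ ((v : ℂ) - 1) =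
      ((x ^ (u - 1) * (1 - x) ^ (v - 1) : ℝ) : ℂ) := by
    intro x hx
    push_cast [Complex.ofReal_cpow hx.1.le, Complex.ofReal_cpow (sub_nonneg.2 hx.2.le)]
    rfl
  rw [setIntegral_congr_fun measurableSet_Ioo this, integral_complex_ofReal, Complex.ofReal_re]

/-- The substitution x = 1/(t⁴ + 1) turns four times the integral into the Beta value B(1/4, 1/4) =
Γ(1/4)²/Γ(1/2). -/
lemma integral_lemniscate :
    ∫ t in Ioi (0 : ℝ), 1 / √(t ^ 4 + 1) = Real.Gamma (1 / 4) ^ 2 / (4 * √π) := by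
  have hd : ∀ t ∈ Ioi (0 : ℝ), HasDerivWithinAt (fun t : ℝ => (t ^ 4 + 1)⁻¹)
      (-(4 * t ^ 3) / (t ^ 4 + 1) ^ 2) (Ioi 0) t := by
    intro t _
    have := (((hasDerivAt_pow 4 t).add_const 1).fun_inv (by positivity)).hasDerivWithinAt
      (s := Ioi 0)
    simpa using this
  have hinj : InjOn (fun t : ℝ => (t ^ 4 + 1)⁻¹) (Ioi 0) := by
    intro s (hs : 0 < s) t (ht : 0 < t) h
    have h1 : s ^ 4 = t ^ 4 := by simpa using h
    exact (pow_left_inj₀ hs.le ht.le (by norm_num)).1 h1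
  have himg : (fun t : ℝ => (t ^ 4 + 1)⁻¹) '' Ioi 0 = Ioo 0 1 := by
    ext x
    constructor
    · rintro ⟨t, ht : 0 < t, rfl⟩
      exact ⟨by positivity, inv_lt_one_of_one_lt₀ (by simp; positivity)⟩
    · rintro ⟨h0, h1⟩
      have h2 : 0 < x⁻¹ - 1 := sub_pos.2 ((one_lt_inv₀ h0).2 h1)
      refine ⟨(x⁻¹ - 1) ^ (1 / 4 : ℝ), Real.rpow_pos_of_pos h2 _, ?_⟩
      simp only
      rw [← Real.rpow_natCast, ← Real.rpow_mul h2.le]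
      norm_num
  have h := integral_image_eq_integral_abs_deriv_smul measurableSet_Ioi hd hinj
    (fun x => x ^ ((1 / 4 : ℝ) - 1) * (1 - x) ^ ((1 / 4 : ℝ) - 1))
  rw [himg, ← beta_eq_integral (by norm_num) (by norm_num)] at h
  have h3 : ∫ t in Ioi (0 : ℝ), |-(4 * t ^ 3) / (t ^ 4 + 1) ^ 2| •
      (((t ^ 4 + 1)⁻¹) ^ ((1 / 4 : ℝ) - 1) * (1 - (t ^ 4 + 1)⁻¹) ^ ((1 / 4 : ℝ) - 1)) =
      ∫ t in Ioi (0 : ℝ), 4 * (1 / √(t ^ 4 + 1)) := by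
    refine setIntegral_congr_fun measurableSet_Ioi fun t (ht : 0 < t) => ?_
    have hw : 0 < t ^ 4 + 1 := by positivity
    have e1 : 1 - (t ^ 4 + 1)⁻¹ = t ^ 4 * (t ^ 4 + 1)⁻¹ := by field_simp; ring
    have e2 : (t ^ 4) ^ ((1 / 4 : ℝ) - 1) = (t ^ 3)⁻¹ := by
      rw [← Real.rpow_natCast, ← Real.rpow_mul ht.le, ← Real.rpow_natCast, ← Real.rpow_neg ht.le]
      norm_num
    have e3 : ((t ^ 4 + 1)⁻¹) ^ ((1 / 4 : ℝ) - 1) * ((t ^ 4 + 1)⁻¹) ^ ((1 / 4 : ℝ) - 1) =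
        (t ^ 4 + 1) * √(t ^ 4 + 1) := by
      rw [← Real.rpow_add (by positivity), Real.inv_rpow hw.le, ← Real.rpow_neg hw.le,
        Real.sqrt_eq_rpow]
      nth_rw 2 [← Real.rpow_one (t ^ 4 + 1)]
      rw [← Real.rpow_add hw]
      norm_num
    have e4 := Real.mul_self_sqrt hw.le
    have e5 : 0 < √(t ^ 4 + 1) := Real.sqrt_pos.2 hw
    have e6 : |-(4 * t ^ 3) / (t ^ 4 + 1) ^ 2| = 4 * t ^ 3 / (t ^ 4 + 1) ^ 2 := by
      rw [neg_div, abs_neg, abs_of_pos (by positivity)]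
    rw [e1, Real.mul_rpow (by positivity) (by positivity), e2, e6, smul_eq_mul]
    calc 4 * t ^ 3 / (t ^ 4 + 1) ^ 2 * (((t ^ 4 + 1)⁻¹) ^ ((1 / 4 : ℝ) - 1) *
          ((t ^ 3)⁻¹ * ((t ^ 4 + 1)⁻¹) ^ ((1 / 4 : ℝ) - 1)))
        = 4 / (t ^ 4 + 1) ^ 2 * (((t ^ 4 + 1)⁻¹) ^ ((1 / 4 : ℝ) - 1) *
          ((t ^ 4 + 1)⁻¹) ^ ((1 / 4 : ℝ) - 1)) := by field_simp
      _ = 4 * (1 / √(t ^ 4 + 1)) := by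
        rw [e3]
        field_simp
        linear_combination e4
  rw [h3, integral_const_mul, ProbabilityTheory.beta] at h
  have e : (1 / 4 + 1 / 4 : ℝ) = 1 / 2 := by norm_num
  rw [e, Real.Gamma_one_half_eq] at h
  have hp : 0 < √π := Real.sqrt_pos.2 Real.pi_pos
  field_simp at h ⊢
  linarith

end

/-! ### The value of θ₃ at 1. -/

section

open Filter Topology Set

/-- The restriction of `phiSeries` to real arguments. -/
noncomputable def phiReal (r : ℝ) : ℝ := ∑' n : ℤ, r ^ sqExp n

lemma ofReal_phiReal (r : ℝ) : (phiReal r : ℂ) = phiSeries r := by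
  rw [phiReal, phiSeries, Complex.ofReal_tsum]
  push_cast
  rfl

lemma phiReal_ne_zero {r : ℝ} (hr : |r| < 1) : phiReal r ≠ 0 := by
  have h := phiSeries_ne_zero (q := r) (by simpa using hr)
  rw [← ofReal_phiReal] at h
  exact_mod_cast h

lemma phiReal_pos {r : ℝ} (h0 : 0 ≤ r) (hr : r < 1) : 0 < phiReal r :=
  lt_of_le_of_ne (tsum_nonneg fun _ => by positivity)
    (phiReal_ne_zero (by rwa [abs_of_nonneg h0])).symm

lemma phiReal_sq_add {r : ℝ} (hr : |r| < 1) :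
    2 * phiReal (r ^ 2) ^ 2 = phiReal r ^ 2 + phiReal (-r) ^ 2 := by
  have hr' : ‖(r : ℂ)‖ < 1 := by simpa using hr
  have h : (2 * phiSeries (r ^ 2) ^ 2 : ℂ) = phiSeries r ^ 2 + phiSeries (-r) ^ 2 := by
    rw [phiSeries_sq hr', phiSeries_neg_sq hr']; ring
  have e : (r : ℂ) ^ 2 = ((r ^ 2 : ℝ) : ℂ) := by push_cast; rfl
  have e' : -(r : ℂ) = ((-r : ℝ) : ℂ) := by push_cast; rfl
  rw [e, e', ← ofReal_phiReal, ← ofReal_phiReal, ← ofReal_phiReal] at h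
  exact_mod_cast h

lemma phiReal_sq_mul {r : ℝ} (hr : |r| < 1) :
    (phiReal (-r ^ 2) ^ 2) ^ 2 = phiReal r ^ 2 * phiReal (-r) ^ 2 := by
  have hr' : ‖(r : ℂ)‖ < 1 := by simpa using hr
  have h := phiSeries_mul_neg_sq hr'
  have e : -(r : ℂ) ^ 2 = ((-r ^ 2 : ℝ) : ℂ) := by push_cast; rfl
  have e' : -(r : ℂ) = ((-r : ℝ) : ℂ) := by push_cast; rfl
  rw [e, e', ← ofReal_phiReal, ← ofReal_phiReal, ← ofReal_phiReal] at h
  have h' : (phiReal r * phiReal (-r)) ^ 2 = phiReal (-r ^ 2) ^ 4 := by exact_mod_cast h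
  rw [← pow_mul, ← h', mul_pow]

lemma tendsto_phiReal {x : ℕ → ℝ} (hx : Tendsto x atTop (𝓝 0)) :
    Tendsto (fun n => phiReal (x n) ^ 2) atTop (𝓝 1) := by
  have h1 : Tendsto (fun n => phiSeries (x n)) atTop (𝓝 (phiSeries 0)) :=
    (continuousAt_phiSeries (by simp)).tendsto.comp
      ((Complex.continuous_ofReal.tendsto' 0 0 Complex.ofReal_zero).comp hx)
  rw [phiSeries_zero] at h1
  have h2 := (Complex.continuous_re.tendsto _).comp h1
  simp only [Function.comp_def, ← ofReal_phiReal, Complex.ofReal_re, Complex.one_re] at h2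
  simpa using h2.pow 2

/-- The squares of φ at r^(2^n) and -r^(2^n) form an AGM sequence with limit 1, by `phiReal_sq_add`
and `phiReal_sq_mul`. -/
lemma ellipticI_phiReal {r : ℝ} (h0 : 0 ≤ r) (hr : r < 1) :
    ellipticI (phiReal r ^ 2) (phiReal (-r) ^ 2) = π / 2 := by
  have hlt : ∀ n : ℕ, |r ^ 2 ^ n| < 1 := fun n => by
    rw [abs_of_nonneg (by positivity)]; exact pow_lt_one₀ h0 hr (by positivity)
  have ht : Tendsto (fun n : ℕ => r ^ 2 ^ n) atTop (𝓝 0) :=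
    (tendsto_pow_atTop_nhds_zero_of_lt_one h0 hr).comp
      (tendsto_pow_atTop_atTop_of_one_lt one_lt_two)
  have h := ellipticI_eq_of_tendsto (a := fun n => phiReal (r ^ 2 ^ n) ^ 2)
    (b := fun n => phiReal (-r ^ 2 ^ n) ^ 2)
    (fun n => by have := phiReal_ne_zero (hlt n); positivity)
    (fun n => by have := phiReal_ne_zero (r := -r ^ 2 ^ n) (by rw [abs_neg]; exact hlt n); positivity)
    (fun n => by rw [pow_succ 2 n, pow_mul, phiReal_sq_add (hlt n)])
    (fun n => by rw [pow_succ 2 n, pow_mul, phiReal_sq_mul (hlt n)])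
    (tendsto_phiReal ht) (tendsto_phiReal (by simpa using ht.neg))
  simpa using h

lemma theta3_eq_jTheta3 (x : ℂ) : theta3 x = jTheta3 (Complex.I * x) := by
  rw [theta3_eq_jacobiTheta, jTheta3_eq, jacobiTheta_eq_jacobiTheta₂]

lemma sFactor_I : sFactor Complex.I = 1 := by
  simp [sFactor]

/-- The point i is fixed by the inversion, which exchanges θ₂ and θ₄. -/
lemma jTheta2_I : jTheta2 Complex.I = jTheta4 Complex.I := by
  have h := jTheta2_inv (τ := Complex.I) (by simp)
  have e : -1 / Complex.I = Complex.I := by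
    rw [div_eq_iff Complex.I_ne_zero, Complex.I_mul_I]
  rwa [e, sFactor_I, one_mul] at h

lemma nome_I : nome Complex.I = ((Real.exp (-π) : ℝ) : ℂ) := by
  rw [nome, mul_assoc, Complex.I_mul_I]
  push_cast
  ring_nf

/-- The value `π^(1/4) / Γ(3/4)` of `theta3` at `1`. -/
noncomputable def thetaOne : ℝ := π ^ (1 / 4 : ℝ) / Real.Gamma (3 / 4)

lemma thetaOne_pos : 0 < thetaOne :=
  div_pos (Real.rpow_pos_of_pos Real.pi_pos _) (Real.Gamma_pos_of_pos (by norm_num))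

lemma Gamma_quarter_mul : Real.Gamma (1 / 4) * Real.Gamma (3 / 4) = π * √2 := by
  have h := Real.Gamma_mul_Gamma_one_sub (1 / 4)
  have e : (1 - 1 / 4 : ℝ) = 3 / 4 := by norm_num
  have e2 : π * (1 / 4) = π / 4 := by ring
  rw [e, e2, Real.sin_pi_div_four] at h
  rw [h]
  have h2 := Real.mul_self_sqrt (zero_le_two (α := ℝ))
  have h3 : 0 < √2 := Real.sqrt_pos.2 two_pos
  field_simp
  linarith

lemma thetaOne_sq : thetaOne ^ 2 = √π / Real.Gamma (3 / 4) ^ 2 := by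
  rw [thetaOne, div_pow, ← Real.rpow_natCast (π ^ (1 / 4 : ℝ)), ← Real.rpow_mul Real.pi_pos.le,
    Real.sqrt_eq_rpow]
  norm_num

lemma Gamma_quarter_sq : Real.Gamma (1 / 4) ^ 2 = 2 * π * √π * thetaOne ^ 2 := by
  have h0 : 0 < Real.Gamma (3 / 4) := Real.Gamma_pos_of_pos (by norm_num)
  have h1 := Gamma_quarter_mul
  have h2 := Real.mul_self_sqrt (zero_le_two (α := ℝ))
  have h3 := Real.mul_self_sqrt Real.pi_pos.le
  rw [thetaOne_sq]
  field_simp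
  linear_combination (Real.Gamma (1 / 4) * Real.Gamma (3 / 4) + π * √2) * h1 + π ^ 2 * h2 -
    2 * π * h3

theorem phiReal_exp_neg_pi : phiReal (Real.exp (-π)) = thetaOne := by
  have hr : Real.exp (-π) < 1 := Real.exp_lt_one_iff.2 (by linarith [Real.pi_pos])
  have hpos := phiReal_pos (Real.exp_pos (-π)).le hr
  have hne : phiReal (-Real.exp (-π)) ≠ 0 :=
    phiReal_ne_zero (by rwa [abs_neg, abs_of_pos (Real.exp_pos _)])
  have h4 := jTheta3_pow_four (τ := Complex.I) (by simp)
  rw [jTheta2_I, jTheta3, jTheta4, nome_I, ← Complex.ofReal_neg, ← ofReal_phiReal,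
    ← ofReal_phiReal] at h4
  have h5 : phiReal (Real.exp (-π)) ^ 4 = 2 * phiReal (-Real.exp (-π)) ^ 4 := by
    have : phiReal (Real.exp (-π)) ^ 4 =
      phiReal (-Real.exp (-π)) ^ 4 + phiReal (-Real.exp (-π)) ^ 4 := by exact_mod_cast h4
    linarith
  have hI := ellipticI_phiReal (Real.exp_pos (-π)).le hr
  set a := phiReal (Real.exp (-π)) with ha
  set b := phiReal (-Real.exp (-π)) with hb
  have hab : b ^ 2 = a ^ 2 * (b ^ 2 / a ^ 2) := by field_simp
  -- Since θ₂ = θ₄ at i, Jacobi's identity reads a⁴ = 2b⁴: the ratio b²/a² is the lemniscatic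
  -- modulus. Scaling by a² then compares π/2 with the Beta value.
  have h6 : 2 * (b ^ 2 / a ^ 2) ^ 2 = 1 := by
    field_simp
    linarith
  have h7 := ellipticI_smul (c := a ^ 2) (by positivity) 1 (b ^ 2 / a ^ 2)
  rw [← hab, mul_one, hI, ellipticI_lemniscate h6, integral_lemniscate, Gamma_quarter_sq] at h7
  have h8 : 0 < √π := Real.sqrt_pos.2 Real.pi_pos
  have h9 : a ^ 2 = thetaOne ^ 2 := by
    have := Real.pi_pos
    field_simp at h7
    linarith
  exact (pow_left_inj₀ hpos.le thetaOne_pos.le two_ne_zero).1 h9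

theorem theta3_one : theta3 1 = thetaOne := by
  rw [theta3_eq_jTheta3, mul_one, jTheta3, nome_I, ← ofReal_phiReal, phiReal_exp_neg_pi]

theorem thetaPhi_eq : thetaPhi = π ^ 2 * thetaOne ^ 8 / 8 := by
  have h3 := Real.mul_self_sqrt Real.pi_pos.le
  have e : Real.Gamma (1 / 4) ^ 8 = (2 * π * √π * thetaOne ^ 2) ^ 4 := by
    rw [← Gamma_quarter_sq]; ring
  have e2 : √π ^ 4 = π ^ 2 := by
    linear_combination (√π ^ 2 + π) * h3
  rw [thetaPhi, thetaOmega, e, mul_pow, mul_pow, mul_pow, e2]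
  have := Real.pi_pos
  field_simp
  ring

end

/-! ### The differential system on the disk and integrality of the Taylor coefficients. -/

section

open Filter Topology Complex

section PolynomialODE

variable {U : Set ℂ} {c : ℂ} {F y m : ℂ → ℂ}
  (hF : ∀ z ∈ U, HasDerivAt F (c * (F z * y z)) z)
  (hy : ∀ z ∈ U, HasDerivAt y (c * (2 * y z ^ 2 + F z ^ 8 - 2 * m z ^ 2)) z)
  (hm : ∀ z ∈ U, HasDerivAt m (c * (4 * y z * m z + 2 * F z ^ 8 - 4 * m z ^ 2)) z)

include hF hy hm

/-- The system is c times a derivation of ℤ[F, y, m], so each differentiation costs one factor c and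
keeps integer coefficients. -/
lemma exists_polynomial_hasDerivAt (P : MvPolynomial (Fin 3) ℤ) :
    ∃ Q : MvPolynomial (Fin 3) ℤ, ∀ z ∈ U,
      HasDerivAt (fun z => MvPolynomial.aeval ![F z, y z, m z] P)
        (c * MvPolynomial.aeval ![F z, y z, m z] Q) z := by
  induction P using MvPolynomial.induction_on with
  | C a => exact ⟨0, fun z _ => by simpa using hasDerivAt_const z (a : ℂ)⟩
  | add p q hp hq =>
    obtain ⟨p', hp'⟩ := hp
    obtain ⟨q', hq'⟩ := hq
    refine ⟨p' + q', fun z hz => ?_⟩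
    simp only [map_add]
    exact ((hp' z hz).fun_add (hq' z hz)).congr_deriv (by ring)
  | mul_X p i hp =>
    obtain ⟨p', hp'⟩ := hp
    have hX : ∃ Q : MvPolynomial (Fin 3) ℤ, ∀ z ∈ U,
        HasDerivAt (fun z => (![F z, y z, m z] : Fin 3 → ℂ) i)
          (c * MvPolynomial.aeval ![F z, y z, m z] Q) z := by
      fin_cases i
      · exact ⟨.X 0 * .X 1, fun z hz => by simpa using hF z hz⟩
      · exact ⟨2 * .X 1 ^ 2 + .X 0 ^ 8 - 2 * .X 2 ^ 2, fun z hz => by simpa using hy z hz⟩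
      · exact ⟨4 * .X 1 * .X 2 + 2 * .X 0 ^ 8 - 4 * .X 2 ^ 2, fun z hz => by simpa using hm z hz⟩
    obtain ⟨q', hq'⟩ := hX
    refine ⟨p' * .X i + p * q', fun z hz => ?_⟩
    simp only [map_mul, map_add, MvPolynomial.aeval_X]
    exact ((hp' z hz).fun_mul (hq' z hz)).congr_deriv (by ring)

lemma exists_polynomial_iteratedDeriv (hU : IsOpen U) (n : ℕ) :
    ∃ P : MvPolynomial (Fin 3) ℤ, ∀ z ∈ U,
      iteratedDeriv n F z = c ^ n * MvPolynomial.aeval ![F z, y z, m z] P := by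
  induction n with
  | zero => exact ⟨.X 0, fun z _ => by simp⟩
  | succ n ih =>
    obtain ⟨P, hP⟩ := ih
    obtain ⟨Q, hQ⟩ := exists_polynomial_hasDerivAt hF hy hm P
    refine ⟨Q, fun z hz => ?_⟩
    rw [iteratedDeriv_succ]
    have h := ((hQ z hz).const_mul (c ^ n)).congr_of_eventuallyEq (f₁ := iteratedDeriv n F) (by
      filter_upwards [hU.mem_nhds hz] with w hw using hP w hw)
    rw [h.deriv]
    ring

/-- The Taylor coefficients at a point where the initial values are integers are integers, up to
powers of the scale. -/
lemma exists_int_iteratedDeriv (hU : IsOpen U) (h0 : (0 : ℂ) ∈ U) (hF0 : F 0 = 1) (hy0 : y 0 = 0)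
    (hm0 : m 0 = 0) (n : ℕ) : ∃ e : ℤ, iteratedDeriv n F 0 = c ^ n * e := by
  obtain ⟨P, hP⟩ := exists_polynomial_iteratedDeriv hF hy hm hU n
  refine ⟨MvPolynomial.aeval ![1, 0, 0] P, ?_⟩
  rw [hP 0 h0, hF0, hy0, hm0]
  congr 1
  have h := (MvPolynomial.aeval_algebraMap_apply (R := ℤ) (A := ℤ) ℂ ![1, 0, 0] P)
  rw [← eq_intCast (algebraMap ℤ ℂ), ← h]
  congr 1
  ext i
  fin_cases i <;> simp

end PolynomialODE

/-! ### Transport of the theta functions to the disk by the Cayley transform. -/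

/-- The point of the upper half plane corresponding to a point of the unit disk. -/
noncomputable def diskPoint (z : ℂ) : ℂ := I * ((1 - z) / (1 + z))

lemma one_add_re_pos {z : ℂ} (hz : ‖z‖ < 1) : 0 < (1 + z).re := by
  have := (abs_le.1 (abs_re_le_norm z)).1
  simp only [add_re, one_re]
  linarith

lemma one_add_ne_zero {z : ℂ} (hz : ‖z‖ < 1) : 1 + z ≠ 0 := by
  intro h
  have := one_add_re_pos hz
  simp [h] at this

lemma cayley_re_pos {z : ℂ} (hz : ‖z‖ < 1) : 0 < ((1 - z) / (1 + z)).re := by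
  have h1 := normSq_pos.2 (one_add_ne_zero hz)
  have h2 : normSq z < 1 := by
    rw [normSq_eq_norm_sq]; exact pow_lt_one₀ (norm_nonneg z) hz two_ne_zero
  rw [normSq_apply] at h2
  rw [div_re, ← add_div]
  refine div_pos ?_ h1
  simp
  nlinarith

lemma diskPoint_im_pos {z : ℂ} (hz : ‖z‖ < 1) : 0 < (diskPoint z).im := by
  simpa [diskPoint] using cayley_re_pos hz

lemma hasDerivAt_diskPoint {z : ℂ} (hz : ‖z‖ < 1) :
    HasDerivAt diskPoint (-2 * I / (1 + z) ^ 2) z := by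
  have h0 := one_add_ne_zero hz
  have h := (((hasDerivAt_id' z).const_sub 1).fun_div ((hasDerivAt_id' z).const_add 1) h0).const_mul I
  refine h.congr_deriv ?_
  field_simp
  ring

lemma diskPoint_zero : diskPoint 0 = I := by simp [diskPoint]

lemma diskPoint_neg {z : ℂ} (hz : ‖z‖ < 1) : diskPoint (-z) = -1 / diskPoint z := by
  have h0 := one_add_ne_zero hz
  have h1 := one_add_ne_zero (z := -z) (by rwa [norm_neg])
  rw [← sub_eq_add_neg] at h1
  rw [diskPoint, diskPoint, sub_neg_eq_add, ← sub_eq_add_neg]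
  field_simp
  rw [I_sq]

lemma sigma3_eq (z : ℂ) : sigma3 z = 1 / (1 + z) ^ (1 / 2 : ℂ) * jTheta3 (diskPoint z) := by
  rw [sigma3, theta3_eq_jTheta3, diskPoint]

lemma cpow_half_sq (z : ℂ) : (z ^ (1 / 2 : ℂ)) ^ 2 = z := by
  rw [← cpow_nat_mul]; norm_num

lemma sigma3_pow_four (z : ℂ) :
    sigma3 z ^ 4 = jTheta3 (diskPoint z) ^ 4 / (1 + z) ^ 2 := by
  have h : ((1 + z) ^ (1 / 2 : ℂ)) ^ 4 = (1 + z) ^ 2 := by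
    rw [show 4 = 2 * 2 from rfl, pow_mul, cpow_half_sq]
  rw [sigma3_eq, mul_pow, div_pow, h, one_pow]
  ring

/-- The logarithmic derivative of `sigma3`. -/
noncomputable def sigmaLog (z : ℂ) : ℂ :=
  -1 / (2 * (1 + z)) + 2 * π * logD jTheta3 (diskPoint z) / (1 + z) ^ 2

/-- The fourth power of `θ₂`, transported to the disk. -/
noncomputable def sigmaTwo (z : ℂ) : ℂ := jTheta2 (diskPoint z) ^ 4 / (1 + z) ^ 2

/-- The fourth power of `θ₄`, transported to the disk. -/
noncomputable def sigmaFour (z : ℂ) : ℂ := jTheta4 (diskPoint z) ^ 4 / (1 + z) ^ 2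

lemma sigma3_pow_four' {z : ℂ} (hz : ‖z‖ < 1) : sigma3 z ^ 4 = sigmaTwo z + sigmaFour z := by
  rw [sigma3_pow_four, jTheta3_pow_four (diskPoint_im_pos hz), sigmaTwo, sigmaFour, add_div]

lemma hasDerivAt_sigma3 {z : ℂ} (hz : ‖z‖ < 1) :
    HasDerivAt sigma3 (sigma3 z * sigmaLog z) z := by
  have h0 := one_add_ne_zero hz
  have hc : (1 + z) ^ (1 / 2 : ℂ) ≠ 0 := by simp [cpow_eq_zero_iff, h0]
  have h1 := ((hasDerivAt_id' z).const_add 1).cpow_const (c := 1 / 2)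
    (Or.inl (one_add_re_pos hz))
  have h2 := (isUnitOnUpperHalf_jTheta3.hasDerivAt (diskPoint_im_pos hz)).comp z
    (hasDerivAt_diskPoint hz)
  have h3 := (((hasDerivAt_const z (1 : ℂ)).fun_div h1 hc).fun_mul h2)
  rw [funext sigma3_eq]
  refine h3.congr_deriv ?_
  have e : (1 + z) ^ ((1 / 2 : ℂ) - 1) = (1 + z) ^ (1 / 2 : ℂ) / (1 + z) := by
    rw [cpow_sub _ _ h0, cpow_one]
  rw [e, sigmaLog, Function.comp]
  field_simp
  ring_nf
  rw [I_sq]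
  ring

/-- The weight factor in z contributes -1/(2(1+z)) to the logarithmic derivative, and this absorbs
the anomaly of the Cayley transform: the equation keeps the shape of `logD₂_jTheta3`. -/
lemma hasDerivAt_sigmaLog {z : ℂ} (hz : ‖z‖ < 1) :
    HasDerivAt sigmaLog (2 * sigmaLog z ^ 2 + π ^ 2 / 2 * (sigmaTwo z * sigmaFour z)) z := by
  have h0 := one_add_ne_zero hz
  have h1 := (hasDerivAt_id' z).const_add 1
  have h2 := (isUnitOnUpperHalf_jTheta3.hasDerivAt_logD (diskPoint_im_pos hz)).comp z
    (hasDerivAt_diskPoint hz)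
  rw [logD₂_jTheta3 (diskPoint_im_pos hz)] at h2
  have h3 := (((hasDerivAt_const z (-1 : ℂ)).fun_div (h1.const_mul 2)
    (mul_ne_zero two_ne_zero h0))).fun_add
    ((h2.const_mul (2 * π : ℂ)).fun_div (h1.fun_pow 2) (pow_ne_zero 2 h0))
  refine h3.congr_deriv ?_
  rw [sigmaLog, sigmaTwo, sigmaFour, Function.comp]
  field_simp
  ring_nf
  simp only [I_sq]
  ring

lemma hasDerivAt_sigmaTwo {z : ℂ} (hz : ‖z‖ < 1) :
    HasDerivAt sigmaTwo (sigmaTwo z * (4 * sigmaLog z + 2 * π * sigmaFour z)) z := by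
  have h0 := one_add_ne_zero hz
  have h1 := (hasDerivAt_id' z).const_add 1
  have h2 := (isUnitOnUpperHalf_jTheta2.hasDerivAt (diskPoint_im_pos hz)).comp z
    (hasDerivAt_diskPoint hz)
  rw [logD_jTheta2 (diskPoint_im_pos hz)] at h2
  have h3 := (h2.fun_pow 4).fun_div (h1.fun_pow 2) (pow_ne_zero 2 h0)
  refine h3.congr_deriv ?_
  rw [sigmaLog, sigmaTwo, sigmaFour, Function.comp]
  field_simp
  ring_nf
  simp only [I_sq]
  ring

lemma hasDerivAt_sigmaFour {z : ℂ} (hz : ‖z‖ < 1) :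
    HasDerivAt sigmaFour (sigmaFour z * (4 * sigmaLog z - 2 * π * sigmaTwo z)) z := by
  have h0 := one_add_ne_zero hz
  have h1 := (hasDerivAt_id' z).const_add 1
  have h2 := (isUnitOnUpperHalf_jTheta4.hasDerivAt (diskPoint_im_pos hz)).comp z
    (hasDerivAt_diskPoint hz)
  rw [logD_jTheta4 (diskPoint_im_pos hz)] at h2
  have h3 := (h2.fun_pow 4).fun_div (h1.fun_pow 2) (pow_ne_zero 2 h0)
  refine h3.congr_deriv ?_
  rw [sigmaLog, sigmaTwo, sigmaFour, Function.comp]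
  field_simp
  ring_nf
  simp only [I_sq]
  ring

/-- At the fixed point i, `logD_inv` determines the logarithmic derivative of θ₃ to be 1/(4π), which
cancels -1/2. -/
lemma sigmaLog_zero : sigmaLog 0 = 0 := by
  have h := logD_inv isUnitOnUpperHalf_jTheta3 isUnitOnUpperHalf_jTheta3 (fun _ => jTheta3_inv)
    (τ := I) (by simp)
  have e : -1 / I = I := by rw [div_eq_iff I_ne_zero, I_mul_I]
  have hπ : (π : ℂ) ≠ 0 := by exact_mod_cast Real.pi_ne_zero
  have hI := I_ne_zero
  rw [e, I_sq] at h
  rw [sigmaLog, diskPoint_zero]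
  field_simp at h
  field_simp
  linear_combination h

lemma sigma3_zero : sigma3 0 = thetaOne := by
  rw [sigma3]; simp [theta3_one]

/-- Negating z is the inversion τ ↦ -1/τ, and the weight factor (1+z)^(-1/2) compensates the
automorphy factor. -/
lemma sigma3_neg {z : ℂ} (hz : ‖z‖ < 1) : sigma3 (-z) = sigma3 z := by
  have h0 := one_add_ne_zero hz
  have h1 := one_add_ne_zero (z := -z) (by rwa [norm_neg])
  have hx := cayley_re_pos hz
  have hx0 : (1 - z) / (1 + z) ≠ 0 := by intro h; simp [h] at hx
  rw [sigma3_eq, sigma3_eq, diskPoint_neg hz, jTheta3_inv (diskPoint_im_pos hz), sFactor]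
  have e1 : -I * diskPoint z = (1 - z) / (1 + z) := by
    rw [diskPoint, ← mul_assoc, neg_mul, I_mul_I, neg_neg, one_mul]
  have e2 : 1 + -z = (1 - z) / (1 + z) * (1 + z) := by field_simp; ring
  -- Both (1-z)/(1+z) and 1+z lie in the right half plane, so their arguments add up to less than π
  -- in absolute value and the principal square roots multiply.
  have a1 := abs_lt.1 (abs_arg_lt_pi_div_two_iff.2 (Or.inl hx))
  have a2 := abs_lt.1 (abs_arg_lt_pi_div_two_iff.2 (Or.inl (one_add_re_pos hz)))
  have e3 : (1 + -z) ^ (1 / 2 : ℂ) = ((1 - z) / (1 + z)) ^ (1 / 2 : ℂ) * (1 + z) ^ (1 / 2 : ℂ) := by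
    rw [cpow_def_of_ne_zero h1, cpow_def_of_ne_zero hx0, cpow_def_of_ne_zero h0, ← exp_add,
      ← add_mul, e2, log_mul_eq_add_log_iff hx0 h0 |>.2 ⟨by linarith [a1.1, a2.1],
        by linarith [a1.2, a2.2]⟩]
  have hc : (1 + z) ^ (1 / 2 : ℂ) ≠ 0 := by simp [cpow_eq_zero_iff, h0]
  have hc' : ((1 - z) / (1 + z)) ^ (1 / 2 : ℂ) ≠ 0 := by
    rw [Ne, cpow_eq_zero_iff]; exact fun h => hx0 h.1
  rw [e1, e3]
  field_simp

/-- The square root of `thetaPhi`. -/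
noncomputable def sqrtPhi : ℝ := π * thetaOne ^ 4 / (2 * √2)

lemma sqrtPhi_pos : 0 < sqrtPhi := by
  have := thetaOne_pos
  have := Real.pi_pos
  unfold sqrtPhi
  positivity

lemma sqrtPhi_sq : sqrtPhi ^ 2 = thetaPhi := by
  rw [thetaPhi_eq, sqrtPhi, div_pow, mul_pow, mul_pow, Real.sq_sqrt zero_le_two]
  ring

lemma exists_int_iteratedDeriv_sigma3 (n : ℕ) :
    ∃ e : ℤ, iteratedDeriv n sigma3 0 = thetaOne * ((sqrtPhi : ℂ) ^ n * e) := by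
  have hs : ((√2 : ℝ) : ℂ) ^ 2 = 2 := by
    rw [← ofReal_pow, Real.sq_sqrt zero_le_two]; norm_num
  have hs0 : ((√2 : ℝ) : ℂ) ≠ 0 := by
    intro h; rw [h] at hs; norm_num at hs
  have ht0 : (thetaOne : ℂ) ≠ 0 := by exact_mod_cast thetaOne_pos.ne'
  have hπ : (π : ℂ) ≠ 0 := by exact_mod_cast Real.pi_ne_zero
  have hc0 : (sqrtPhi : ℂ) ≠ 0 := by exact_mod_cast sqrtPhi_pos.ne'
  have hc : 2 * ((√2 : ℝ) : ℂ) * sqrtPhi = π * (thetaOne : ℂ) ^ 4 := by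
    rw [sqrtPhi]; push_cast; field_simp
  have hπ2 : (π : ℂ) ^ 2 = 8 * (sqrtPhi : ℂ) ^ 2 / (thetaOne : ℂ) ^ 8 := by
    field_simp
    linear_combination -(2 * ((√2 : ℝ) : ℂ) * sqrtPhi + π * (thetaOne : ℂ) ^ 4) * hc +
      4 * (sqrtPhi : ℂ) ^ 2 * hs
  have hinv : ((((√2 : ℝ) : ℂ) * (thetaOne : ℂ) ^ 4)⁻¹) ^ 2 = (2 * (thetaOne : ℂ) ^ 8)⁻¹ := by
    rw [inv_pow, mul_pow, hs]; ring
  have hp : (((√2 : ℝ) : ℂ) * (thetaOne : ℂ) ^ 4)⁻¹ * π = 2 * sqrtPhi / (thetaOne : ℂ) ^ 8 := by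
    field_simp
    linear_combination -hc
  -- With A and B for `sigmaTwo` and `sigmaFour`, σ₃⁴ = A + B and 4AB = σ₃⁸ - (A - B)². Dividing A -
  -- B by √2 θ₃(1)⁴ and taking c = √Φ = πθ₃(1)⁴/(2√2) makes all coefficients of the system integers.
  -- The initial value of m is 0 because θ₂ = θ₄ at i.
  have key := exists_int_iteratedDeriv (U := Metric.ball 0 1) (c := sqrtPhi)
    (F := fun z => (thetaOne : ℂ)⁻¹ * sigma3 z) (y := fun z => (sqrtPhi : ℂ)⁻¹ * sigmaLog z)
    (m := fun z => (((√2 : ℝ) : ℂ) * (thetaOne : ℂ) ^ 4)⁻¹ * (sigmaTwo z - sigmaFour z))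
    (fun z hz => by
      have hz' := mem_ball_zero_iff.1 hz
      refine ((hasDerivAt_sigma3 hz').const_mul _).congr_deriv ?_
      field_simp)
    (fun z hz => by
      have hz' := mem_ball_zero_iff.1 hz
      refine ((hasDerivAt_sigmaLog hz').const_mul _).congr_deriv ?_
      have e : sigma3 z ^ 8 = (sigmaTwo z + sigmaFour z) ^ 2 := by
        rw [← sigma3_pow_four' hz']; ring
      rw [mul_pow _ (sigma3 z), e]
      rw [mul_pow _ (sigmaTwo z - sigmaFour z), hinv, hπ2]
      field_simp
      ring)
    (fun z hz => by
      have hz' := mem_ball_zero_iff.1 hz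
      refine (((hasDerivAt_sigmaTwo hz').fun_sub (hasDerivAt_sigmaFour hz')).const_mul _).congr_deriv
        ?_
      have e : sigma3 z ^ 8 = (sigmaTwo z + sigmaFour z) ^ 2 := by
        rw [← sigma3_pow_four' hz']; ring
      rw [mul_pow _ (sigma3 z), e]
      rw [mul_pow _ (sigmaTwo z - sigmaFour z), hinv]
      generalize (((√2 : ℝ) : ℂ) * (thetaOne : ℂ) ^ 4)⁻¹ = k at hp
      field_simp at hp ⊢
      linear_combination 8 * sigmaTwo z * sigmaFour z * hp)
    Metric.isOpen_ball (Metric.mem_ball_self one_pos) (by rw [sigma3_zero, inv_mul_cancel₀ ht0])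
    (by rw [sigmaLog_zero, mul_zero])
    (by rw [sigmaTwo, sigmaFour, diskPoint_zero, jTheta2_I, sub_self, mul_zero]) n
  obtain ⟨e, he⟩ := key
  refine ⟨e, ?_⟩
  rw [← he, iteratedDeriv_const_mul_field]
  field_simp

lemma iteratedDeriv_sigma3_odd (n : ℕ) : iteratedDeriv (2 * n + 1) sigma3 0 = 0 := by
  have h : (fun z => sigma3 (-z)) =ᶠ[𝓝 0] sigma3 := by
    filter_upwards [ball_mem_nhds (q := 0) (by simp)] with z hz
    exact sigma3_neg (mem_ball_zero_iff.1 hz)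
  have h1 := h.iteratedDeriv_eq (2 * n + 1)
  rw [iteratedDeriv_comp_neg, neg_zero, Odd.neg_one_pow ⟨n, rfl⟩, neg_one_smul] at h1
  have h2 : (2 : ℂ) * iteratedDeriv (2 * n + 1) sigma3 0 = 0 := by linear_combination -h1
  simpa using h2

theorem exists_isSigma3Coeff : ∃ d : ℕ → ℤ, IsSigma3Coeff d ∧
    ∀ n, iteratedDeriv (2 * n) sigma3 0 = thetaOne * ((thetaPhi : ℂ) ^ n * d n) := by
  choose e he using fun n : ℕ => exists_int_iteratedDeriv_sigma3 (2 * n)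
  have e2 : ∀ n : ℕ, (sqrtPhi : ℂ) ^ (2 * n) = (thetaPhi : ℂ) ^ n := fun n => by
    rw [pow_mul, ← sqrtPhi_sq]; push_cast; rfl
  simp only [e2] at he
  refine ⟨e, fun z hz => ?_, he⟩
  have hd : DifferentiableOn ℂ sigma3 (Metric.ball 0 1) := fun z hz =>
    (hasDerivAt_sigma3 (mem_ball_zero_iff.1 hz)).differentiableAt.differentiableWithinAt
  have h := Complex.hasSum_taylorSeries_on_ball hd (mem_ball_zero_iff.2 hz)
  have hinj : Function.Injective fun n : ℕ => 2 * n := fun a b h => by simpa using h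
  rw [← hinj.hasSum_iff (fun n hn => ?_)] at h
  · refine h.congr_fun fun n => ?_
    simp only [Function.comp, smul_eq_mul, sub_zero, he, theta3_one]
    ring
  · rcases Nat.even_or_odd' n with ⟨k, rfl | rfl⟩
    · exact absurd ⟨k, rfl⟩ hn
    · rw [iteratedDeriv_sigma3_odd]; simp

end

/-! ### Derivatives of θ₃ at 1 and the moment formula. -/

section

open Filter Topology Complex

/-- The series `∑ (-2πn²)^k exp (-πn²(1 + 2u))` of the `k`-th derivative of
`u ↦ theta3 (1 + 2 * u)`. -/
noncomputable def thetaDeriv (k : ℕ) (u : ℂ) : ℂ :=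
  ∑' n : ℤ, (-2 * π * (n : ℂ) ^ 2) ^ k * cexp (-π * (n : ℂ) ^ 2 * (1 + 2 * u))

lemma summable_thetaDeriv_bound (k : ℕ) {δ : ℝ} (hδ : 0 < δ) :
    Summable fun n : ℤ => (2 * π * (n : ℝ) ^ 2) ^ k * Real.exp (-π * (n : ℝ) ^ 2 * δ) := by
  have h := (summable_pow_mul_jacobiTheta₂_term_bound 0 hδ (2 * k)).mul_left ((2 * π) ^ k)
  refine h.congr fun n => ?_
  rw [pow_mul, Int.cast_abs, sq_abs, mul_pow]
  ring_nf

lemma norm_thetaDeriv_term_le (k : ℕ) {δ : ℝ} {u : ℂ} (hu : δ < (1 + 2 * u).re) (n : ℤ) :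
    ‖(-2 * π * (n : ℂ) ^ 2) ^ k * cexp (-π * (n : ℂ) ^ 2 * (1 + 2 * u))‖ ≤
      (2 * π * (n : ℝ) ^ 2) ^ k * Real.exp (-π * (n : ℝ) ^ 2 * δ) := by
  have e : -(π : ℂ) * (n : ℂ) ^ 2 * (1 + 2 * u) = ((-π * (n : ℝ) ^ 2 : ℝ) : ℂ) * (1 + 2 * u) := by
    push_cast; ring
  rw [norm_mul, norm_pow, norm_exp, e, re_ofReal_mul]
  have h1 : ‖-2 * (π : ℂ) * (n : ℂ) ^ 2‖ = 2 * π * (n : ℝ) ^ 2 := by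
    simp [abs_of_pos Real.pi_pos]
  rw [h1]
  gcongr ?_ * Real.exp ?_
  nlinarith [mul_nonneg Real.pi_pos.le (sq_nonneg (n : ℝ))]

lemma isOpen_re_one_add_two_mul_gt (δ : ℝ) : IsOpen {u : ℂ | δ < (1 + 2 * u).re} :=
  isOpen_lt continuous_const (by fun_prop)

lemma hasSum_thetaDeriv (k : ℕ) {u : ℂ} (hu : 0 < (1 + 2 * u).re) :
    HasSum (fun n : ℤ => (-2 * π * (n : ℂ) ^ 2) ^ k * cexp (-π * (n : ℂ) ^ 2 * (1 + 2 * u)))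
      (thetaDeriv k u) := by
  obtain ⟨δ, h0, hδ⟩ := exists_between hu
  exact (Summable.of_norm_bounded (summable_thetaDeriv_bound k h0)
    (norm_thetaDeriv_term_le k hδ)).hasSum

lemma hasDerivAt_thetaDeriv (k : ℕ) {u : ℂ} (hu : 0 < (1 + 2 * u).re) :
    HasDerivAt (thetaDeriv k) (thetaDeriv (k + 1) u) u := by
  obtain ⟨δ, h0, hδ⟩ := exists_between hu
  have hterm : ∀ (n : ℤ) (u : ℂ), HasDerivAt
      (fun u => (-2 * π * (n : ℂ) ^ 2) ^ k * cexp (-π * (n : ℂ) ^ 2 * (1 + 2 * u)))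
      ((-2 * π * (n : ℂ) ^ 2) ^ (k + 1) * cexp (-π * (n : ℂ) ^ 2 * (1 + 2 * u))) u := by
    intro n u
    have h := (((((hasDerivAt_id' u).const_mul 2).const_add 1).const_mul
      (-π * (n : ℂ) ^ 2)).cexp).const_mul ((-2 * π * (n : ℂ) ^ 2) ^ k)
    exact h.congr_deriv (by ring)
  have hd : ∀ n : ℤ, DifferentiableOn ℂ
      (fun u => (-2 * π * (n : ℂ) ^ 2) ^ k * cexp (-π * (n : ℂ) ^ 2 * (1 + 2 * u)))
      {u : ℂ | δ < (1 + 2 * u).re} :=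
    fun n u _ => (hterm n u).differentiableAt.differentiableWithinAt
  have h1 := hasSum_deriv_of_summable_norm (summable_thetaDeriv_bound k h0) hd (isOpen_re_one_add_two_mul_gt δ)
    (fun n w hw => norm_thetaDeriv_term_le k hw n) (z := u) hδ
  have h2 := (differentiableOn_tsum_of_summable_norm (summable_thetaDeriv_bound k h0) hd
    (isOpen_re_one_add_two_mul_gt δ) (fun n w hw => norm_thetaDeriv_term_le k hw n)).differentiableAt
    ((isOpen_re_one_add_two_mul_gt δ).mem_nhds hδ)
  have h3 := h2.hasDerivAt
  rw [h1.unique ((hasSum_thetaDeriv (k + 1) hu).congr_fun fun n => (hterm n u).deriv)] at h3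
  exact h3

lemma iteratedDeriv_theta3 (k : ℕ) {u : ℂ} (hu : 0 < (1 + 2 * u).re) :
    iteratedDeriv k (fun u => theta3 (1 + 2 * u)) u = thetaDeriv k u := by
  induction k generalizing u with
  | zero =>
    rw [iteratedDeriv_zero, theta3, thetaDeriv]
    simp only [pow_zero, one_mul]
  | succ k ih =>
    rw [iteratedDeriv_succ]
    refine HasDerivAt.deriv ((hasDerivAt_thetaDeriv k hu).congr_of_eventuallyEq ?_)
    filter_upwards [(isOpen_re_one_add_two_mul_gt 0).mem_nhds hu] with w hw using ih hw

lemma iteratedDeriv_pow_mul {g : ℂ → ℂ} (hg : AnalyticAt ℂ g 0) (i k : ℕ) :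
    iteratedDeriv k (fun u => u ^ i * g u) 0 =
      if i ≤ k then (k.choose i * i ! : ℂ) * iteratedDeriv (k - i) g 0 else 0 := by
  rw [iteratedDeriv_fun_mul (by fun_prop) hg.contDiffAt]
  simp only [iteratedDeriv_fun_pow_zero]
  split_ifs with h
  · rw [Finset.sum_eq_single i]
    · simp
    · intro b _ hb
      simp [hb]
    · intro h'
      exact absurd (Finset.mem_range.2 (Nat.lt_succ_of_le h)) h'
  · refine Finset.sum_eq_zero fun b hb => ?_
    have : b ≠ i := by rintro rfl; exact h (Nat.lt_succ_iff.1 (Finset.mem_range.1 hb))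
    simp [this]

lemma one_add_re_pos' {u : ℂ} (hu : ‖u‖ < 1) : 1 + u ∈ slitPlane := Or.inl (one_add_re_pos hu)

lemma iteratedDeriv_one_add_cpow (b : ℂ) (m : ℕ) {u : ℂ} (hu : ‖u‖ < 1) :
    iteratedDeriv m (fun u : ℂ => (1 + u) ^ b) u =
      (∏ l ∈ Finset.range m, (b - l)) * (1 + u) ^ (b - m) := by
  induction m generalizing u with
  | zero => simp
  | succ m ih =>
    rw [iteratedDeriv_succ]
    have h1 := (((hasDerivAt_id' u).const_add 1).cpow_const (c := b - m)
      (one_add_re_pos' hu)).const_mul (∏ l ∈ Finset.range m, (b - l))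
    have h2 := h1.congr_of_eventuallyEq (f₁ := iteratedDeriv m (fun u : ℂ => (1 + u) ^ b)) (by
      filter_upwards [ball_mem_nhds hu] with w hw using ih (mem_ball_zero_iff.1 hw))
    rw [h2.deriv, Finset.prod_range_succ]
    push_cast
    ring_nf

/-- Each factor is -(4j + 2l + 1)/2; multiplying by the missing even numbers 4j + 2l + 2 = 2(2j + l
+ 1) completes the product to quotients of factorials. -/
lemma prod_half_sub (j m : ℕ) :
    (∏ l ∈ Finset.range m, (-(1 / 2) - 2 * j - l : ℂ)) * ((4 * j)! * (2 * j + m)! * 4 ^ m) =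
      (-1) ^ m * ((4 * j + 2 * m)! * (2 * j)!) := by
  induction m with
  | zero => simp
  | succ m ih =>
    rw [Finset.prod_range_succ, ← add_assoc (2 * j), Nat.factorial_succ (2 * j + m),
      show 4 * j + 2 * (m + 1) = 4 * j + 2 * m + 1 + 1 by ring, Nat.factorial_succ (4 * j + 2 * m + 1),
      Nat.factorial_succ (4 * j + 2 * m)]
    push_cast at ih ⊢
    linear_combination (-(1 / 2) - 2 * j - m : ℂ) * (2 * j + m + 1) * 4 * ih

lemma choose_mul_prod_half_sub (j m : ℕ) :
    ((2 * j + m).choose (2 * j) : ℂ) *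
      ∏ l ∈ Finset.range m, (-(1 / 2) - 2 * j - l : ℂ) =
      (-1) ^ m * (4 * j + 2 * m)! / ((4 * j)! * m ! * 4 ^ m) := by
  have hp := prod_half_sub j m
  have hc : ((2 * j + m).choose (2 * j) : ℂ) * ((2 * j)! * m !) = (2 * j + m)! := by
    have := Nat.choose_mul_factorial_mul_factorial (Nat.le_add_right (2 * j) m)
    rw [Nat.add_sub_cancel_left] at this
    rw [← mul_assoc]; exact_mod_cast this
  have f1 : ((2 * j)! : ℂ) ≠ 0 := by exact_mod_cast Nat.factorial_ne_zero _
  have f2 : (m ! : ℂ) ≠ 0 := by exact_mod_cast Nat.factorial_ne_zero _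
  have f3 : ((4 * j)! : ℂ) ≠ 0 := by exact_mod_cast Nat.factorial_ne_zero _
  rw [eq_div_iff (mul_ne_zero (mul_ne_zero f3 f2) (pow_ne_zero _ (by norm_num)))]
  refine mul_right_cancel₀ f1 ?_
  rw [← hc] at hp
  linear_combination hp

lemma analyticAt_one_add_cpow (b : ℂ) : AnalyticAt ℂ (fun u : ℂ => (1 + u) ^ b) 0 :=
  (analyticAt_const.add analyticAt_id).cpow analyticAt_const (one_add_re_pos' (by simp))

/-- The point z = -u/(1+u) solves (1-z)/(1+z) = 1 + 2u, and 1 + z = 1/(1+u). -/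
lemma theta3_eq_sigma3 {u : ℂ} (hu : ‖u‖ < 1) :
    theta3 (1 + 2 * u) = (1 + u) ^ (-(1 / 2) : ℂ) * sigma3 (-u / (1 + u)) := by
  have h0 := one_add_ne_zero hu
  have e1 : 1 + -u / (1 + u) = (1 + u)⁻¹ := by field_simp; ring
  have e2 : (1 - -u / (1 + u)) / (1 + u)⁻¹ = 1 + 2 * u := by field_simp; ring
  have hc : (1 + u) ^ (1 / 2 : ℂ) ≠ 0 := by simp [cpow_eq_zero_iff, h0]
  rw [sigma3, e1, e2, inv_cpow _ _ (slitPlane_arg_ne_pi (one_add_re_pos' hu)), cpow_neg]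
  field_simp

lemma sum_range_two_mul {M : Type*} [AddCommMonoid M] (g : ℕ → M) (hg : ∀ j, g (2 * j + 1) = 0)
    (N : ℕ) : ∑ i ∈ Finset.range (2 * N), g i = ∑ j ∈ Finset.range N, g (2 * j) := by
  induction N with
  | zero => simp
  | succ N ih =>
    rw [show 2 * (N + 1) = 2 * N + 1 + 1 by ring, Finset.sum_range_succ, Finset.sum_range_succ, ih,
      hg, add_zero, Finset.sum_range_succ]

theorem iteratedDeriv_theta3_eq_sum (k : ℕ) :
    iteratedDeriv k (fun u => theta3 (1 + 2 * u)) 0 = ∑ j ∈ Finset.range (k / 2 + 1),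
      iteratedDeriv (2 * j) sigma3 0 * (k.choose (2 * j) *
        ∏ l ∈ Finset.range (k - 2 * j), (-(1 / 2) - (2 * j : ℕ) - l : ℂ)) := by
  -- With 2N > k, the remainder u^(2N) times an analytic function has zero k-th derivative at 0, so
  -- a finite Taylor expansion of σ₃ suffices and no infinite sum is differentiated.
  set N := k / 2 + 1 with hN
  have hd : DifferentiableOn ℂ sigma3 (Metric.ball 0 1) := fun z hz =>
    (hasDerivAt_sigma3 (mem_ball_zero_iff.1 hz)).differentiableAt.differentiableWithinAt
  obtain ⟨R, hR, hR'⟩ := (hd.analyticAt (ball_mem_nhds (by simp))).exists_eventuallyEq_sum_add_pow_mul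
    (2 * N)
  have hz : AnalyticAt ℂ (fun u : ℂ => -u / (1 + u)) 0 :=
    analyticAt_id.neg.div (analyticAt_const.add analyticAt_id) (by simp)
  have ht : Tendsto (fun u : ℂ => -u / (1 + u)) (𝓝 0) (𝓝 0) := by
    simpa using hz.continuousAt.tendsto
  have hRz : AnalyticAt ℂ (fun u : ℂ => R (-u / (1 + u))) 0 :=
    AnalyticAt.fun_comp (by simpa using hR) hz
  have hH : AnalyticAt ℂ (fun u : ℂ => (1 + u) ^ (-(1 / 2) - (2 * N : ℕ) : ℂ) * R (-u / (1 + u))) 0 :=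
    (analyticAt_one_add_cpow _).mul hRz
  have hrem : ContDiffAt ℂ k (fun u : ℂ =>
      u ^ (2 * N) * ((1 + u) ^ (-(1 / 2) - (2 * N : ℕ) : ℂ) * R (-u / (1 + u)))) 0 :=
    ((analyticAt_id.pow (2 * N)).mul hH).contDiffAt
  have hev : (fun u => theta3 (1 + 2 * u)) =ᶠ[𝓝 0] fun u =>
      (∑ i ∈ Finset.range (2 * N), (iteratedDeriv i sigma3 0 / i ! * (-1) ^ i) *
        (u ^ i * (1 + u) ^ (-(1 / 2) - i : ℂ))) +
      u ^ (2 * N) * ((1 + u) ^ (-(1 / 2) - (2 * N : ℕ) : ℂ) * R (-u / (1 + u))) := by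
    filter_upwards [ht.eventually hR', ball_mem_nhds (q := 0) (by simp)] with u h1 hu
    rw [mem_ball_zero_iff] at hu
    have h0 := one_add_ne_zero hu
    have hpow : ∀ i : ℕ, (1 + u) ^ (-(1 / 2) - i : ℂ) = (1 + u) ^ (-(1 / 2) : ℂ) / (1 + u) ^ i :=
      fun i => by rw [cpow_sub _ _ h0, cpow_natCast]
    rw [theta3_eq_sigma3 hu, h1, mul_add, Finset.mul_sum]
    congr 1
    · refine Finset.sum_congr rfl fun i _ => ?_
      rw [hpow, smul_eq_mul, div_pow, neg_pow]
      ring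
    · rw [hpow, smul_eq_mul, div_pow, Even.neg_pow (even_two_mul N)]
      ring
  have hg : ∀ i : ℕ, AnalyticAt ℂ (fun u : ℂ => u ^ i * (1 + u) ^ (-(1 / 2) - i : ℂ)) 0 :=
    fun i => (analyticAt_id.pow i).mul (analyticAt_one_add_cpow _)
  have hg' : ∀ i ∈ Finset.range (2 * N), ContDiffAt ℂ k (fun u : ℂ =>
      (iteratedDeriv i sigma3 0 / i ! * (-1) ^ i) * (u ^ i * (1 + u) ^ (-(1 / 2) - i : ℂ))) 0 :=
    fun i _ => (analyticAt_const.mul (hg i)).contDiffAt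
  rw [hev.iteratedDeriv_eq, iteratedDeriv_fun_add (ContDiffAt.sum hg') hrem, iteratedDeriv_fun_sum hg',
    iteratedDeriv_pow_mul hH, if_neg (by omega), add_zero, sum_range_two_mul]
  · refine Finset.sum_congr rfl fun j hj => ?_
    have hj' : 2 * j ≤ k := by have := Finset.mem_range.1 hj; omega
    rw [iteratedDeriv_const_mul_field, iteratedDeriv_pow_mul (analyticAt_one_add_cpow _), if_pos hj',
      iteratedDeriv_one_add_cpow _ _ (by simp)]
    have hf : ((2 * j)! : ℂ) ≠ 0 := by exact_mod_cast Nat.factorial_ne_zero _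
    simp only [add_zero, one_cpow, mul_one, Even.neg_one_pow (even_two_mul j)]
    field_simp
  · intro j
    simp only [iteratedDeriv_sigma3_odd, zero_div, zero_mul]
    exact iteratedDeriv_const_zero ..

theorem mainTheorem10 :
    ∃ d : ℕ → ℤ, IsSigma3Coeff d ∧
      ∀ k : ℕ,
        HasSum (fun n : ℤ => (n : ℝ) ^ (2 * k) * Real.exp (-π * (n : ℝ) ^ 2))
          (π ^ (1 / 4 : ℝ) / Real.Gamma (3 / 4) * (1 / (4 * π) ^ k) *
            ∑ j ∈ Finset.range (k / 2 + 1),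
              ((2 * k)! : ℝ) / (2 ^ (k - 2 * j) * ((4 * j)! : ℝ) * ((k - 2 * j)! : ℝ)) *
                (d j : ℝ) * thetaOmega ^ j) := by
  obtain ⟨d, hd, hd'⟩ := exists_isSigma3Coeff
  refine ⟨d, hd, fun k => ?_⟩
  rw [← thetaOne, ← Complex.hasSum_ofReal]
  have hπ : (π : ℂ) ≠ 0 := by exact_mod_cast Real.pi_ne_zero
  -- At u = 0 the derivative series is (-2π)^k times the moment series.
  have h := (hasSum_thetaDeriv k (u := 0) (by simp)).mul_left (((-2 * π : ℂ) ^ k)⁻¹)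
  rw [← iteratedDeriv_theta3 k (by simp), iteratedDeriv_theta3_eq_sum] at h
  have h' := h.congr_fun (g := fun n : ℤ =>
    (((n : ℝ) ^ (2 * k) * Real.exp (-π * (n : ℝ) ^ 2) : ℝ) : ℂ)) (fun n => by
      push_cast
      rw [mul_pow _ ((n : ℂ) ^ 2), ← pow_mul, mul_zero, add_zero, mul_one, mul_assoc,
        inv_mul_cancel_left₀]
      exact pow_ne_zero _ (mul_ne_zero (by norm_num) hπ))
  refine Eq.subst (motive := fun a => HasSum _ a) ?_ h'
  push_cast
  rw [Finset.mul_sum, Finset.mul_sum]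
  refine Finset.sum_congr rfl fun j hj => ?_
  obtain ⟨m, rfl⟩ : ∃ m, k = 2 * j + m := ⟨k - 2 * j, by
    have := Finset.mem_range.1 hj; omega⟩
  have e1 : (thetaOmega : ℂ) = 4 * thetaPhi := by rw [thetaPhi]; push_cast; ring
  rw [hd', e1, Nat.add_sub_cancel_left, choose_mul_prod_half_sub]
  have f2 : (m ! : ℂ) ≠ 0 := by exact_mod_cast Nat.factorial_ne_zero _
  have f3 : ((4 * j)! : ℂ) ≠ 0 := by exact_mod_cast Nat.factorial_ne_zero _
  -- The sign (-1)^m cancels against that in `choose_mul_prod_half_sub`, and the powers of 4 balance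
  -- through Ω^j = 4^j Φ^j.
  have g1 : (-2 * π : ℂ) ^ (2 * j + m) = (-1) ^ m * 4 ^ j * 2 ^ m * π ^ (2 * j + m) := by
    rw [mul_pow, pow_add (-2 : ℂ), pow_mul, neg_pow (2 : ℂ) m]; norm_num; ring
  have g2 : (4 * π : ℂ) ^ (2 * j + m) = (4 ^ j) ^ 2 * 4 ^ m * π ^ (2 * j + m) := by
    rw [mul_pow, pow_add (4 : ℂ)]; ring
  rw [g1, g2, mul_pow, show 2 * (2 * j + m) = 4 * j + 2 * m by ring]
  field_simp

end
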